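/- \textbf{Theorem (Equivalence of VRAs and VPAs).} Let $\widetilde\Sigma=\Sigma_{int}\cup\Sigma_{call}\cup\Sigma_{ret}$ be a pushdown alphabet, i.e. a union of three pairwise disjoint finite alphabets. The set $WM(\widetilde\Sigma)$ of well-matched words is the smallest set that contains $\Sigma_{int}^*$ and is closed under concatenation and under $w\mapsto cwr$ for $c\in\Sigma_{call}$, $r\in\Sigma_{ret}$. A \emph{visibly recursive automaton} (VRA) $\mathcal A$ over $\widetilde\Sigma$ consists of a finite set $\Sigma_{proc}$ of procedural symbols, a linking function $f=(f_{call},f_{ret}):\Sigma_{proc}\to\Sigma_{call}\times\Sigma_{ret}$, and nondeterministic finite automata $\mathcal A^J$, $J\in\Sigma_{proc}\cup\{S\}$ with $S\notin\Sigma_{proc}$, over $\Sigma_{int}\cup\Sigma_{proc}$, with pairwise disjoint finite state sets $Q^J$, transition sets $\delta^J$, initial states $I^J$ and final states $F^J$. Put $Q=\bigcup_J Q^J$, $\delta=\bigcup_J\delta^J$ and $|\mathcal A|=|Q|+|\delta|$. Configurations are pairs $\langle q,\sigma\rangle\in Q\times Q^*$. Reading $a\in\Sigma_{int}$ leads from $\langle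 q,\sigma\rangle$ to $\langle q',\sigma\rangle$ if $(q,a,q')\in\delta$. Reading $c\in\Sigma_{call}$ leads from $\langle q,\sigma\rangle$ to $\langle q',p\sigma\rangle$ if for some $J\in\Sigma_{proc}$: $f_{call}(J)=c$, $q'\in I^J$ and $(q,J,p)\in\delta$. Reading $r\in\Sigma_{ret}$ leads from $\langle q,q'\sigma\rangle$ to $\langle q',\sigma\rangle$ if for some $J\in\Sigma_{proc}$: $f_{ret}(J)=r$ and $q\in F^J$. The language $L(\mathcal A)$ is the set of words that lead from $\langle q,\varepsilon\rangle$ to $\langle p,\varepsilon\rangle$ for some $q\in I^S$, $p\in F^S$. A \emph{visibly pushdown automaton} (VPA) $\mathcal B$ over $\widetilde\Sigma$ consists of a finite stack alphabet $\Gamma$, a finite state set $Q$, sets $I,F\subseteq Q$ of initial and final states, and transitions $\delta_{int}\subseteq Q\times\Sigma_{int}\times Q$, $\delta_{call}\subseteq Q\times\Sigma_{call}\times Q\times\Gamma$ (pushing a stack symbol), $\delta_{ret}\subseteq Q\times\Sigma_{ret}\times\Gamma\times Q$ (popping a stack symbol). It accepts the words that lead from an initial state with empty stack to a final state with empty stack,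 and $|\mathcal B|=|Q|+|\delta_{int}|+|\delta_{call}|+|\delta_{ret}|$. \begin{enumerate} \item Let $L\subseteq WM(\widetilde\Sigma)$. Then $L=L(\mathcal A)$ for some VRA $\mathcal A$ over $\widetilde\Sigma$ if and only if $L=L(\mathcal B)$ for some VPA $\mathcal B$ over $\widetilde\Sigma$. \item There is a logspace-computable function that maps every VRA $\mathcal A$ to a VPA $\mathcal B$ over the same pushdown alphabet with $L(\mathcal B)=L(\mathcal A)$ and $|\mathcal B|\le K|\mathcal A|^2$, where $K$ is an absolute constant. \item There is a logspace-computable function that maps every VPA $\mathcal B$ to a VRA $\mathcal A$ over the same pushdown alphabet with $L(\mathcal A)=L(\mathcal B)$ and $|\mathcal A|\le K|\mathcal B|^4$, where the constant $K$ depends only on the pushdown alphabet. \end{enumerate} Here automata are encoded as binary words with all symbols and states numbered, cardinalities written in unary and relations written as tables of bits. A function is logspace-computable if some deterministic Turing machine with a read-only input tape, finitely many work tapes and a write-only output tape computes it on the encodings, using $O(\log n)$ work tape cells on encodings of length $n$. -/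

import Mathlib

/-! ### Words over a pushdown alphabet -/

/-- The letters of the pushdown alphabet whose internal, call and return symbols are the elements
of `I`, `C` and `R`; the constructors make the three alphabets disjoint. -/
inductive Letter (I C R : Type*) where
  | int (a : I)
  | call (c : C)
  | ret (r : R)

/-- The well-matched words over a pushdown alphabet. -/
inductive WellMatched {I C R : Type*} : List (Letter I C R) → Prop where
  | internal (u : List I) : WellMatched (u.map Letter.int)
  | nest (c : C) (r : R) {w : List (Letter I C R)} (hw : WellMatched w) :
      WellMatched (Letter.call c :: w ++ [Letter.ret r])
  | concat {w₁ w₂ : List (Letter I C R)} (h₁ : WellMatched w₁) (h₂ : WellMatched w₂) :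
      WellMatched (w₁ ++ w₂)

/-- `LabelledRun step κ w κ'`: reading the word `w` letter by letter, the transition relation `step`
leads from the configuration `κ` to the configuration `κ'`. -/
inductive LabelledRun {K α : Type*} (step : K → α → K → Prop) : K → List α → K → Prop where
  | nil (κ : K) : LabelledRun step κ [] κ
  | cons {κ κ' κ'' : K} {a : α} {w : List α} (h : step κ a κ') (t : LabelledRun step κ' w κ'') :
      LabelledRun step κ (a :: w) κ''

/-! ### Visibly recursive automata -/

/-- A visibly recursive automaton with procedural symbols `P`. It has one finite automaton with
states `Q (some J)` for each `J : P` and the starting automaton, with states `Q none`; all of them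
read internal and procedural symbols. All these types are to be finite. -/
structure VRA (I C R P : Type*) (Q : Option P → Type*) where
  /-- the linking function -/
  link : P → C × R
  /-- the automata; the starting one is `aut none` -/
  aut : ∀ J : Option P, NFA (I ⊕ P) (Q J)

namespace VRA

variable {I C R P : Type*} {Q : Option P → Type*}

/-- The disjoint union of the state sets of all the automata. -/
abbrev State (_ : VRA I C R P Q) : Type _ := Σ J : Option P, Q J

/-- The union of the transition sets of all the automata. -/
def trans (A : VRA I C R P Q) : Set (A.State × (I ⊕ P) × A.State) :=
  {t | ∃ (J : Option P) (q : Q J) (x : I ⊕ P) (p : Q J),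
    p ∈ (A.aut J).step q x ∧ t = (⟨J, q⟩, x, ⟨J, p⟩)}

/-- The initial states of the automaton `A.aut J`. -/
def initials (A : VRA I C R P Q) (J : Option P) : Set A.State := Sigma.mk J '' (A.aut J).start

/-- The final states of the automaton `A.aut J`. -/
def finals (A : VRA I C R P Q) (J : Option P) : Set A.State := Sigma.mk J '' (A.aut J).accept

/-- The number of states plus the number of transitions. -/
noncomputable def size (A : VRA I C R P Q) : ℕ := Nat.card A.State + A.trans.ncard

/-- One step between configurations (a state and a stack word of states, top first). -/
def Step (A : VRA I C R P Q) :
    A.State × List A.State → Letter I C R → A.State × List A.State → Prop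
  | (q, σ), .int a, (q', σ') => (q, Sum.inl a, q') ∈ A.trans ∧ σ' = σ
  | (q, σ), .call c, (q', σ') => ∃ (J : P) (p : A.State), (A.link J).1 = c ∧
      q' ∈ A.initials (some J) ∧ (q, Sum.inr J, p) ∈ A.trans ∧ σ' = p :: σ
  | (q, σ), .ret r, (q', σ') => ∃ J : P, (A.link J).2 = r ∧
      q ∈ A.finals (some J) ∧ σ = q' :: σ'

/-- The recursive language of the automaton `A.aut J`. -/
def recLanguage (A : VRA I C R P Q) (J : Option P) : Language (Letter I C R) :=
  {w | ∃ q ∈ A.initials J, ∃ p ∈ A.finals J, LabelledRun A.Step (q, []) w (p, [])}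

/-- The language of a visibly recursive automaton. -/
def language (A : VRA I C R P Q) : Language (Letter I C R) := A.recLanguage none

end VRA

/-! ### Visibly pushdown automata -/

/-- A visibly pushdown automaton with stack alphabet `G` and states `Q` (both to be finite),
accepting with empty stack. -/
structure VPA (I C R G Q : Type*) where
  start : Set Q
  accept : Set Q
  intTrans : Set (Q × I × Q)
  callTrans : Set (Q × C × Q × G)
  retTrans : Set (Q × R × G × Q)

namespace VPA

variable {I C R G Q : Type*}

/-- The number of states plus the number of transitions. -/
noncomputable def size (B : VPA I C R G Q) : ℕ :=
  Nat.card Q + (B.intTrans.ncard + B.callTrans.ncard + B.retTrans.ncard)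

/-- One step between configurations (a state and a stack word, top first). -/
def Step (B : VPA I C R G Q) : Q × List G → Letter I C R → Q × List G → Prop
  | (q, σ), .int a, (q', σ') => (q, a, q') ∈ B.intTrans ∧ σ' = σ
  | (q, σ), .call c, (q', σ') => ∃ g : G, (q, c, q', g) ∈ B.callTrans ∧ σ' = g :: σ
  | (q, σ), .ret r, (q', σ') => ∃ g : G, (q, r, g, q') ∈ B.retTrans ∧ σ = g :: σ'

/-- The language of a visibly pushdown automaton. -/
def language (B : VPA I C R G Q) : Language (Letter I C R) :=
  {w | ∃ q ∈ B.start, ∃ p ∈ B.accept, LabelledRun B.Step (q, []) w (p, [])}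

end VPA

/-- `L` is accepted by some visibly recursive automaton. -/
def AcceptedByVRA {I C R : Type*} (L : Language (Letter I C R)) : Prop :=
  ∃ (P : Type) (_ : Finite P) (Q : Option P → Type) (_ : ∀ J, Finite (Q J))
    (A : VRA I C R P Q), A.language = L

/-- `L` is accepted by some visibly pushdown automaton. -/
def AcceptedByVPA {I C R : Type*} (L : Language (Letter I C R)) : Prop :=
  ∃ (G : Type) (_ : Finite G) (Q : Type) (_ : Finite Q)
    (B : VPA I C R G Q), B.language = L

/-! ### Logarithmic-space computability -/

/-- Moves of a tape head. -/
inductive HeadMove where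
  | left
  | stay
  | right

/-- What the input head may scan: an end marker or a bit of the input. -/
inductive InputSymbol where
  | leftEnd
  | bit (b : Bool)
  | rightEnd

/-- A deterministic Turing transducer with a read-only two-way input tape, finitely many read-write
work tapes (infinite to the right, head starting in cell `0`) and a write-only output tape. -/
structure Transducer where
  /-- control states -/
  State : Type
  [finState : Finite State]
  /-- work alphabet -/
  Sym : Type
  [finSym : Finite Sym]
  blank : Sym
  start : State
  /-- number of work tapes -/
  tapes : ℕ
  /-- Given the control state and the scanned symbols, either halt (`none`), or give the new control
  state, the move of the input head, for each work tape the symbol written and the move of the head,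
  and the bit appended to the output, if any. -/
  next : State → InputSymbol → (Fin tapes → Sym) →
    Option (State × HeadMove × (Fin tapes → Sym × HeadMove) × Option Bool)

namespace Transducer

/-- A configuration. -/
structure Config (M : Transducer) where
  state : M.State
  /-- position of the input head: `0` is the left end marker, `1, …, n` are the bits of the input,
  `n + 1` is the right end marker -/
  inPos : ℕ
  work : Fin M.tapes → ℕ → M.Sym
  heads : Fin M.tapes → ℕ
  /-- the output written so far -/
  out : List Bool

/-- The symbol at a position of the input tape. -/
def scan (x : List Bool) : ℕ → InputSymbol
  | 0 => .leftEnd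
  | j + 1 => match x[j]? with
    | some b => .bit b
    | none => .rightEnd

/-- A move of a head on a tape that is infinite to the right; at cell `0`, a move to the left has no
effect. -/
def moveHead : HeadMove → ℕ → ℕ
  | .left, j => j - 1
  | .stay, j => j
  | .right, j => j + 1

/-- The initial configuration. -/
def initial (M : Transducer) : M.Config where
  state := M.start
  inPos := 0
  work := fun _ _ => M.blank
  heads := fun _ => 0
  out := []

/-- One step on the input `x`; `none` if the machine halts. The input head does not leave the input
and its end markers. -/
def step (M : Transducer) (x : List Bool) (κ : M.Config) : Option M.Config :=
  (M.next κ.state (scan x κ.inPos) (fun t => κ.work t (κ.heads t))).map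
    fun (s, m, a, o) =>
      { state := s
        inPos := min (moveHead m κ.inPos) (x.length + 1)
        work := fun t => Function.update (κ.work t) (κ.heads t) (a t).1
        heads := fun t => moveHead (a t).2 (κ.heads t)
        out := κ.out ++ o.toList }

/-- On input `x`, the machine halts with output `y`, and each work head stays in the first `s` cells
of its tape throughout the computation. -/
def ComputesInSpace (M : Transducer) (x y : List Bool) (s : ℕ) : Prop :=
  (∃ κ, StateTransition.Reaches (M.step x) M.initial κ ∧ M.step x κ = none ∧ κ.out = y) ∧
    ∀ κ, StateTransition.Reaches (M.step x) M.initial κ → ∀ t, κ.heads t < s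

end Transducer

/-- A function between two types whose elements are encoded by words over `{0, 1}` is computable in
logarithmic space. -/
def LogspaceComputable {α β : Type*} (encα : α → List Bool) (encβ : β → List Bool)
    (f : α → β) : Prop :=
  ∃ (M : Transducer) (C : ℕ), ∀ a : α,
    M.ComputesInSpace (encα a) (encβ (f a)) (C * (Nat.log 2 (encα a).length + 1))

/-! ### Encodings of automata as binary words

For the purpose of computation, all symbols and states are numbered. Cardinalities are written in
unary, and relations are written as tables of bits. -/

/-- The word `1…10` with `n` ones. -/
def unary (n : ℕ) : List Bool := List.replicate n true ++ [false]

/-- The concatenation of `f 0`, …, `f (n - 1)`. -/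
def table (n : ℕ) (f : Fin n → List Bool) : List Bool := (List.finRange n).flatMap f

open Classical in
/-- The truth value of a proposition, as a word with one letter. -/
noncomputable def truthBit (p : Prop) : List Bool := [decide p]

/-- The numbers of internal, call and return symbols of a pushdown alphabet. -/
structure AlphabetSize where
  int : ℕ
  call : ℕ
  ret : ℕ

/-- The letters of the pushdown alphabet with the given numbers of symbols. -/
abbrev AlphabetSize.Letter (s : AlphabetSize) : Type := _root_.Letter (Fin s.int) (Fin s.call) (Fin s.ret)

/-- A visibly recursive automaton with numbered symbols, procedural symbols and states: `owner q` is
the name of the automaton to which the state `q` belongs. -/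
structure NumVRA (s : AlphabetSize) where
  procs : ℕ
  states : ℕ
  owner : Fin states → Option (Fin procs)
  toVRA : VRA (Fin s.int) (Fin s.call) (Fin s.ret) (Fin procs) (fun J => {q // owner q = J})

namespace NumVRA

variable {s : AlphabetSize}

/-- The language of the automaton. -/
def language (A : NumVRA s) : Language s.Letter := A.toVRA.language

/-- The size of the automaton. -/
noncomputable def size (A : NumVRA s) : ℕ := A.toVRA.size

/-- The state with number `q`. -/
def stateAt (A : NumVRA s) (q : Fin A.states) : A.toVRA.State := ⟨A.owner q, q, rfl⟩

/-- The binary encoding of the automaton: the cardinalities, the linking function, the partition of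
the states, the initial states, the final states, the internal transitions and the procedural
transitions. -/
noncomputable def encode (A : NumVRA s) : List Bool :=
  unary s.int ++ unary s.call ++ unary s.ret ++ unary A.procs ++ unary A.states ++
  table A.procs (fun J => table s.call fun c => truthBit ((A.toVRA.link J).1 = c)) ++
  table A.procs (fun J => table s.ret fun r => truthBit ((A.toVRA.link J).2 = r)) ++
  table A.states (fun q => truthBit (A.owner q = none)) ++
  table A.states (fun q => table A.procs fun J => truthBit (A.owner q = some J)) ++
  table A.states (fun q => truthBit (A.stateAt q ∈ A.toVRA.initials (A.owner q))) ++
  table A.states (fun q => truthBit (A.stateAt q ∈ A.toVRA.finals (A.owner q))) ++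
  table A.states (fun q => table s.int fun a => table A.states fun p =>
    truthBit ((A.stateAt q, Sum.inl a, A.stateAt p) ∈ A.toVRA.trans)) ++
  table A.states (fun q => table A.procs fun J => table A.states fun p =>
    truthBit ((A.stateAt q, Sum.inr J, A.stateAt p) ∈ A.toVRA.trans))

end NumVRA

/-- A visibly pushdown automaton with numbered symbols, stack symbols and states. -/
structure NumVPA (s : AlphabetSize) where
  stackSyms : ℕ
  states : ℕ
  toVPA : VPA (Fin s.int) (Fin s.call) (Fin s.ret) (Fin stackSyms) (Fin states)

namespace NumVPA

variable {s : AlphabetSize}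

/-- The language of the automaton. -/
def language (B : NumVPA s) : Language s.Letter := B.toVPA.language

/-- The size of the automaton. -/
noncomputable def size (B : NumVPA s) : ℕ := B.toVPA.size

/-- The binary encoding of the automaton: the cardinalities, the initial states, the final states
and the three sets of transitions. -/
noncomputable def encode (B : NumVPA s) : List Bool :=
  unary s.int ++ unary s.call ++ unary s.ret ++ unary B.stackSyms ++ unary B.states ++
  table B.states (fun q => truthBit (q ∈ B.toVPA.start)) ++
  table B.states (fun q => truthBit (q ∈ B.toVPA.accept)) ++
  table B.states (fun q => table s.int fun a => table B.states fun p =>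
    truthBit ((q, a, p) ∈ B.toVPA.intTrans)) ++
  table B.states (fun q => table s.call fun c => table B.states fun p => table B.stackSyms fun g =>
    truthBit ((q, c, p, g) ∈ B.toVPA.callTrans)) ++
  table B.states (fun q => table s.ret fun r => table B.stackSyms fun g => table B.states fun p =>
    truthBit ((q, r, g, p) ∈ B.toVPA.retTrans))

end NumVPA

/-!
A visibly recursive automaton already is a visibly pushdown automaton whose stack symbols are its
states: a call pushes the state in which the caller resumes, and a return pops it
(`VRA.toVPA`). The configurations and the steps are the same, so the languages agree
(`VRA.toVPA_language`). As the called automaton determines the procedural symbol, a call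
transition is given by a procedural transition and an entered state, whence the quadratic size.

Conversely, a visibly pushdown automaton `B` with states `S` becomes a visibly recursive one
(`VPA.toVRA`) with procedural symbols `((s, s'), c, r)`: the call `c` enters `s`, and the matching
return `r` leaves `s'`. Every automaton is a copy of the stackless part of `B`, and a transition
that reads `((s, s'), c, r)` replaces a call and a return transition with a common stack symbol.
A run of the recursive automaton is simulated step by step (`VPA.toVRA_language_le`).
In the other direction the recursive automaton has to guess at a call how the call will return, so
its run is constructed from the end (`VPA.exists_toVRA_run`). There are at most quadratically
many copies with at most quadratically many transitions each.

For computability in logarithmic space, both encodings are written by programs of a small language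
(`TableProgram`): nested loops over indices, each bounded by one of the numbers at the beginning of
the input, write the truth values of formulas about input bits, whose addresses are polynomials in
the indices. All indices are at most the length `n` of the input. Every program is executed by a
transducer that keeps each index as a binary counter on a work tape of its own, hence in `O(log n)`
cells, and reads an input bit by moving the input head from the left end as many times as nested
loops over further counters say (`TableProgram.logspaceComputable`). The transducers are
composed from one-step machines by sequencing and iteration (`Subroutine`).
It remains to write the two translations as such programs (`NumVRA.eval_program`,
`NumVPA.eval_program`).
-/

/-! ### From visibly recursive automata to visibly pushdown automata -/

/-- Words can be read along a forward simulation `Rel` of transition relations. -/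
theorem LabelledRun.simulate {K K' α : Type*} {step : K → α → K → Prop} {step' : K' → α → K' → Prop}
    (Rel : K → K' → Prop)
    (hstep : ∀ κ a κ' μ, step κ a κ' → Rel κ μ → ∃ μ', step' μ a μ' ∧ Rel κ' μ')
    {κ κ' : K} {w : List α} (hrun : LabelledRun step κ w κ') {μ : K'} (hμ : Rel κ μ) :
    ∃ μ', LabelledRun step' μ w μ' ∧ Rel κ' μ' := by
  induction hrun generalizing μ with
  | nil κ => exact ⟨μ, .nil μ, hμ⟩
  | cons h _ ih =>
    obtain ⟨ν, hν, hrel⟩ := hstep _ _ _ _ h hμ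
    obtain ⟨ξ, hξ, hrel'⟩ := ih hrel
    exact ⟨ξ, .cons hν hξ, hrel'⟩

namespace VRA

variable {I C R P : Type*} {Q : Option P → Type*}

theorem mk_mem_initials {A : VRA I C R P Q} {J K : Option P} {q : Q K} :
    (⟨K, q⟩ : A.State) ∈ A.initials J ↔ K = J ∧ q ∈ (A.aut K).start := by
  constructor
  · rintro ⟨q', h, heq⟩
    cases heq
    exact ⟨rfl, h⟩
  · rintro ⟨rfl, h⟩
    exact ⟨q, h, rfl⟩

theorem mk_mem_finals {A : VRA I C R P Q} {J K : Option P} {q : Q K} :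
    (⟨K, q⟩ : A.State) ∈ A.finals J ↔ K = J ∧ q ∈ (A.aut K).accept := by
  constructor
  · rintro ⟨q', h, heq⟩
    cases heq
    exact ⟨rfl, h⟩
  · rintro ⟨rfl, h⟩
    exact ⟨q, h, rfl⟩

theorem mk_mem_trans {A : VRA I C R P Q} {J : Option P} {q : Q J} {x : I ⊕ P} {t : A.State} :
    ((⟨J, q⟩ : A.State), x, t) ∈ A.trans ↔ ∃ p ∈ (A.aut J).step q x, t = ⟨J, p⟩ := by
  constructor
  · rintro ⟨J', q', x', p, h, heq⟩
    simp only [Prod.mk.injEq] at heq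
    obtain ⟨h1, rfl, rfl⟩ := heq
    cases h1
    exact ⟨p, h, rfl⟩
  · rintro ⟨p, h, rfl⟩
    exact ⟨J, q, x, p, h, rfl⟩

/-- The visibly pushdown automaton with the same configurations and steps: a call pushes the state
in which the caller resumes. The states are renamed along `e`. -/
def toVPA (A : VRA I C R P Q) {S : Type*} (e : S ≃ A.State) : VPA I C R S S where
  start := {q | e q ∈ A.initials none}
  accept := {q | e q ∈ A.finals none}
  intTrans := {t | (e t.1, Sum.inl t.2.1, e t.2.2) ∈ A.trans}
  callTrans := {t | ∃ J, (A.link J).1 = t.2.1 ∧ e t.2.2.1 ∈ A.initials (some J) ∧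
    (e t.1, Sum.inr J, e t.2.2.2) ∈ A.trans}
  retTrans := {t | (∃ J, (A.link J).2 = t.2.1 ∧ e t.1 ∈ A.finals (some J)) ∧ t.2.2.1 = t.2.2.2}

variable (A : VRA I C R P Q) {S : Type*} (e : S ≃ A.State)

theorem toVPA_step {q q' : S} {σ σ' : List S} {l : Letter I C R} :
    (A.toVPA e).Step (q, σ) l (q', σ') ↔ A.Step (e q, σ.map e) l (e q', σ'.map e) := by
  have hinj := List.map_injective_iff.2 e.injective
  cases l with
  | int a => simp [VPA.Step, VRA.Step, toVPA, hinj.eq_iff]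
  | call c =>
    simp only [VPA.Step, VRA.Step, toVPA, Set.mem_ofPred_eq]
    constructor
    · rintro ⟨g, ⟨J, h1, h2, h3⟩, rfl⟩
      exact ⟨J, e g, h1, h2, h3, rfl⟩
    · rintro ⟨J, p, h1, h2, h3, h4⟩
      refine ⟨e.symm p, ⟨J, h1, h2, by simpa using h3⟩, hinj ?_⟩
      simpa using h4
  | ret r =>
    simp only [VPA.Step, VRA.Step, toVPA, Set.mem_ofPred_eq]
    constructor
    · rintro ⟨g, ⟨⟨J, h1, h2⟩, rfl⟩, rfl⟩
      exact ⟨J, h1, h2, rfl⟩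
    · rintro ⟨J, h1, h2, h3⟩
      exact ⟨q', ⟨⟨J, h1, h2⟩, rfl⟩, hinj (by simpa using h3)⟩

theorem toVPA_language : (A.toVPA e).language = A.language := by
  ext w
  constructor
  · rintro ⟨q, hq, p, hp, hrun⟩
    obtain ⟨μ, hμ, rfl⟩ := hrun.simulate (step' := A.Step)
      (fun κ μ => μ = (e κ.1, κ.2.map e))
      (by
        rintro ⟨q, σ⟩ a ⟨q', σ'⟩ μ h rfl
        exact ⟨_, (A.toVPA_step e).1 h, rfl⟩) rfl
    exact ⟨e q, hq, e p, hp, hμ⟩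
  · rintro ⟨q, hq, p, hp, hrun⟩
    obtain ⟨μ, hμ, hμp⟩ := hrun.simulate (step' := (A.toVPA e).Step)
      (fun κ μ => κ = (e μ.1, μ.2.map e))
      (by
        rintro ⟨q, σ⟩ a ⟨q', σ'⟩ ⟨p, τ⟩ h heq
        rw [heq] at h
        refine ⟨(e.symm q', σ'.map e.symm), (A.toVPA_step e).2 ?_, ?_⟩
        · simpa [Function.comp_def] using h
        · simp [Function.comp_def])
      (μ := (e.symm q, [])) (by simp)
    obtain ⟨p', τ⟩ := μ
    simp only [Prod.mk.injEq, List.nil_eq, List.map_eq_nil_iff] at hμp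
    obtain ⟨rfl, rfl⟩ := hμp
    exact ⟨e.symm q, by simpa [toVPA] using hq, p', hp, hμ⟩

variable [Finite I] [Finite P] [Finite S]

theorem toVPA_size_le : (A.toVPA e).size ≤ 2 * A.size ^ 2 := by
  have : Finite A.State := Finite.of_equiv S e
  have hS : Nat.card S = Nat.card A.State := Nat.card_congr e
  have hint : (A.toVPA e).intTrans.ncard ≤ A.trans.ncard := by
    refine Set.ncard_le_ncard_of_injOn (fun t => (e t.1, Sum.inl t.2.1, e t.2.2))
      (fun t ht => ht) ?_ (Set.toFinite _)
    rintro ⟨q, a, p⟩ _ ⟨q', a', p'⟩ _ h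
    simpa using h
  have hcall : (A.toVPA e).callTrans.ncard ≤ A.trans.ncard * Nat.card S := by
    -- The call symbol is determined by the procedural symbol that owns the entered state.
    let F : (A.State × (I ⊕ P) × A.State) × S → (A.State × Option P × A.State) × S :=
      fun u => ((u.1.1, u.1.2.1.getRight?, u.1.2.2), u.2)
    calc (A.toVPA e).callTrans.ncard ≤ (F '' (A.trans ×ˢ Set.univ)).ncard := by
          refine Set.ncard_le_ncard_of_injOn
            (fun t => ((e t.1, (e t.2.2.1).1, e t.2.2.2), t.2.2.1)) ?_ ?_ (Set.toFinite _)
          · rintro ⟨q, c, p, g⟩ ⟨J, hc, ⟨p', hp', hp⟩, ht⟩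
            refine ⟨((e q, Sum.inr J, e g), p), ⟨ht, trivial⟩, ?_⟩
            simp only [F, ← hp]
            rfl
          · rintro ⟨q, c, p, g⟩ ⟨J, hc, ⟨p₁, _, hp⟩, -⟩
              ⟨q', c', p', g'⟩ ⟨J', hc', ⟨p₂, _, hp'⟩, -⟩ h
            simp only [Prod.mk.injEq, EmbeddingLike.apply_eq_iff_eq] at h hc hc' hp hp' ⊢
            obtain ⟨⟨rfl, -, rfl⟩, rfl⟩ := h
            have := congrArg Sigma.fst (hp.trans hp'.symm)
            simp only [Option.some.injEq] at this
            subst this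
            exact ⟨rfl, hc.symm.trans hc', rfl, rfl⟩
      _ ≤ (A.trans ×ˢ (Set.univ : Set S)).ncard := Set.ncard_image_le (Set.toFinite _)
      _ = _ := by rw [Set.ncard_prod, Set.ncard_univ]
  have hret : (A.toVPA e).retTrans.ncard ≤ Nat.card S * Nat.card S := by
    rw [← Nat.card_prod, ← Set.ncard_univ]
    refine Set.ncard_le_ncard_of_injOn (fun t => (t.1, t.2.2.1)) (fun _ _ => trivial) ?_
      (Set.toFinite _)
    rintro ⟨q, r, g, p⟩ ⟨⟨J, hr, ⟨q₁, _, hq⟩⟩, hg⟩ ⟨q', r', g', p'⟩ ⟨⟨J', hr', ⟨q₂, _, hq'⟩⟩, hg'⟩ h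
    simp only [Prod.mk.injEq] at h hr hr' hq hq' hg hg' ⊢
    obtain ⟨rfl, rfl⟩ := h
    have := congrArg Sigma.fst (hq.trans hq'.symm)
    simp only [Option.some.injEq] at this
    subst this
    exact ⟨rfl, hr.symm.trans hr', rfl, hg.symm.trans hg'⟩
  unfold VPA.size VRA.size
  rw [hS] at *
  have h1 : Nat.card A.State ≤ Nat.card A.State ^ 2 := Nat.le_self_pow (by norm_num) _
  have h2 : A.trans.ncard ≤ A.trans.ncard ^ 2 := Nat.le_self_pow (by norm_num) _
  nlinarith

end VRA

/-! ### From visibly pushdown automata to visibly recursive automata -/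

namespace VPA

variable {I C R G S P : Type*} {Q : Option P → Type*}

/-- The visibly recursive automaton whose procedural symbols stand for the quadruples
`((s, s'), c, r)`, along `φ`. Every automaton is a copy of `B` without stack; the one for
`((s, s'), c, r)` starts in `s` and ends in `s'`, and a transition that reads it
stands for a call `c` that enters `s` and the matching return `r`, which leaves `s'` and pops the
symbol pushed by the call. -/
def toVRA (B : VPA I C R G S) (φ : P ≃ (S × S) × C × R) (e : ∀ J, Q J ≃ S) : VRA I C R P Q where
  link K := (φ K).2
  aut J :=
    { step := fun q x => match x with
        | .inl a => {p | (e J q, a, e J p) ∈ B.intTrans}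
        | .inr K => {p | ∃ g, (e J q, (φ K).2.1, (φ K).1.1, g) ∈ B.callTrans ∧
            ((φ K).1.2, (φ K).2.2, g, e J p) ∈ B.retTrans}
      start := {q | e J q ∈ J.elim B.start fun K => {(φ K).1.1}}
      accept := {q | e J q ∈ J.elim B.accept fun K => {(φ K).1.2}} }

variable (B : VPA I C R G S) (φ : P ≃ (S × S) × C × R) (e : ∀ J, Q J ≃ S)

/-- `B.StackRel φ e J σ γ h`: the stack `σ` of the recursive automaton, in a state of the automaton
`J`, corresponds to the stack `γ` of `B`. The word `h` lists, for each open call, the state that it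
entered and its call symbol. -/
inductive StackRel : Option P → List (Σ J, Q J) → List G → List (S × C) → Prop where
  | nil : StackRel none [] [] []
  | cons {K : P} {J : Option P} {q : Q J} {g : G} {σ : List (Σ J, Q J)} {γ : List G}
      {h : List (S × C)} (hret : ((φ K).1.2, (φ K).2.2, g, e J q) ∈ B.retTrans)
      (ht : StackRel J σ γ h) :
      StackRel (some K) (⟨J, q⟩ :: σ) (g :: γ) (((φ K).1.1, (φ K).2.1) :: h)

theorem toVRA_language_le : (B.toVRA φ e).language ≤ B.language := by
  rintro w ⟨⟨J, q⟩, hq, ⟨J', p⟩, hp, hrun⟩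
  obtain ⟨rfl, hq⟩ := VRA.mk_mem_initials.1 hq
  obtain ⟨rfl, hp⟩ := VRA.mk_mem_finals.1 hp
  obtain ⟨⟨p', γ⟩, hμ, hpp, h, hst⟩ := hrun.simulate (step' := B.Step)
    (fun κ μ => μ.1 = e κ.1.1 κ.1.2 ∧ ∃ h, B.StackRel φ e κ.1.1 κ.2 μ.2 h)
    (by
      rintro ⟨⟨J, q⟩, σ⟩ l ⟨⟨J', q'⟩, σ'⟩ ⟨t, γ⟩ hs ⟨rfl, h, hst⟩
      dsimp only at hst ⊢
      cases l with
      | int a =>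
        obtain ⟨ht, rfl⟩ := hs
        obtain ⟨p, hp, heq⟩ := VRA.mk_mem_trans.1 ht
        cases heq
        exact ⟨(e _ p, γ), ⟨hp, rfl⟩, rfl, h, hst⟩
      | call c =>
        obtain ⟨K, t, rfl, hi, ht, rfl⟩ := hs
        obtain ⟨rfl, hi⟩ := VRA.mk_mem_initials.1 hi
        obtain ⟨p, ⟨g, hc, hr⟩, rfl⟩ := VRA.mk_mem_trans.1 ht
        replace hi : e (some K) q' = (φ K).1.1 := hi
        refine ⟨(e _ q', g :: γ), ⟨g, ?_, rfl⟩, rfl, _, .cons hr hst⟩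
        rw [hi]
        exact hc
      | ret r =>
        obtain ⟨K, rfl, hf, rfl⟩ := hs
        obtain ⟨rfl, hf⟩ := VRA.mk_mem_finals.1 hf
        replace hf : e (some K) q = (φ K).1.2 := hf
        cases hst with
        | cons hret ht =>
          refine ⟨(e _ q', _), ⟨_, ?_, rfl⟩, rfl, _, ht⟩
          rw [hf]
          exact hret)
    (μ := (e none q, [])) ⟨rfl, [], .nil⟩
  dsimp only at hpp hst
  cases hst
  exact ⟨e none q, hq, p', by rw [hpp]; exact hp, hμ⟩

/-- A run of `B` that ends with empty stack is a run of the recursive automaton. As the recursive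
automaton guesses the returns at the calls, its stack depends on the future of the
run; it is constructed from the end of the run, for every history `h` of open calls. -/
theorem exists_toVRA_run {κ : S × List G} {w : List (Letter I C R)} {κ' : S × List G}
    (hrun : LabelledRun B.Step κ w κ') (hκ' : κ'.2 = []) (h : List (S × C))
    (hlen : h.length = κ.2.length) :
    ∃ J σ, B.StackRel φ e J σ κ.2 h ∧ LabelledRun (B.toVRA φ e).Step
      (⟨J, (e J).symm κ.1⟩, σ) w (⟨none, (e none).symm κ'.1⟩, []) := by
  induction hrun generalizing h with
  | nil κ =>
    obtain ⟨q, γ⟩ := κ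
    obtain rfl : γ = [] := hκ'
    obtain rfl : h = [] := List.length_eq_zero_iff.1 hlen
    exact ⟨none, [], .nil, .nil _⟩
  | @cons κ κ₁ κ₂ l w hs _ ih =>
    obtain ⟨q, γ⟩ := κ
    obtain ⟨q₁, γ₁⟩ := κ₁
    cases l with
    | int a =>
      obtain ⟨ht, rfl⟩ := hs
      obtain ⟨J, σ, hst, hrun⟩ := ih hκ' h hlen
      refine ⟨J, σ, hst, .cons ⟨VRA.mk_mem_trans.2 ⟨_, ?_, rfl⟩, rfl⟩ hrun⟩
      simpa [toVRA] using ht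
    | call c =>
      obtain ⟨g, ht, rfl⟩ := hs
      obtain ⟨J, σ, hst, hrun⟩ := ih hκ' ((q₁, c) :: h) (by simpa using hlen)
      dsimp only at hst hrun
      generalize hh : (q₁, c) :: h = h' at hst
      cases hst with
      | @cons K J' q' _ _ _ _ hret hst =>
        simp only [List.cons.injEq, Prod.mk.injEq] at hh
        obtain ⟨⟨rfl, rfl⟩, rfl⟩ := hh
        refine ⟨_, _, hst, .cons ⟨K, _, rfl, VRA.mk_mem_initials.2 ⟨rfl, ?_⟩,
          VRA.mk_mem_trans.2 ⟨q', ?_, rfl⟩, rfl⟩ hrun⟩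
        · simp [toVRA]
        · exact ⟨g, by simpa using ht, hret⟩
    | ret r =>
      obtain ⟨g, ht, rfl⟩ := hs
      obtain _ | ⟨⟨s, c⟩, h⟩ := h
      · simp at hlen
      obtain ⟨J, σ, hst, hrun⟩ := ih hκ' h (by simpa using hlen)
      have hφ := φ.apply_symm_apply ((s, q), c, r)
      generalize φ.symm ((s, q), c, r) = K at hφ
      have hc := StackRel.cons (B := B) (φ := φ) (e := e) (K := K) (J := J)
        (q := (e J).symm q₁) (g := g) (by rw [hφ]; simpa using ht) hst
      rw [hφ] at hc
      refine ⟨some K, _, hc,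
        .cons ⟨K, ?_, VRA.mk_mem_finals.2 ⟨rfl, ?_⟩, rfl⟩ hrun⟩
      · simp [toVRA, hφ]
      · simp [toVRA, hφ]

theorem toVRA_language : (B.toVRA φ e).language = B.language := by
  refine le_antisymm (B.toVRA_language_le φ e) ?_
  rintro w ⟨q, hq, p, hp, hrun⟩
  obtain ⟨J, σ, hst, hrun⟩ := B.exists_toVRA_run φ e hrun rfl [] rfl
  cases hst
  refine ⟨_, VRA.mk_mem_initials.2 ⟨rfl, ?_⟩, _, VRA.mk_mem_finals.2 ⟨rfl, ?_⟩, hrun⟩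
  · simpa [toVRA] using hq
  · simpa [toVRA] using hp

variable [Finite I] [Finite C] [Finite R] [Finite G] [Finite S]

theorem toVRA_size_le :
    (B.toVRA φ e).size ≤ 2 * (Nat.card C * Nat.card R + 1) * B.size ^ 4 := by
  have : Finite P := Finite.of_equiv _ φ.symm
  have hfin : ∀ J, Finite (Q J) := fun J => Finite.of_equiv _ (e J).symm
  have : Finite (B.toVRA φ e).State := inferInstanceAs (Finite (Σ J, Q J))
  have hP : Nat.card (Option P) = Nat.card S ^ 2 * (Nat.card C * Nat.card R) + 1 := by
    rw [Finite.card_option, Nat.card_congr φ]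
    simp only [Nat.card_prod]
    ring
  have hstate : Nat.card (B.toVRA φ e).State = Nat.card (Option P) * Nat.card S := by
    rw [← Nat.card_prod]
    exact Nat.card_congr ((Equiv.sigmaCongrRight e).trans (Equiv.sigmaEquivProd _ _))
  let F : Option P × (S × I × S) → (Σ J, Q J) × (I ⊕ P) × (Σ J, Q J) := fun u =>
    (⟨u.1, (e u.1).symm u.2.1⟩, Sum.inl u.2.2.1, ⟨u.1, (e u.1).symm u.2.2.2⟩)
  let H : Option P × (S × C × S × G) × (S × R × G × S) → (Σ J, Q J) × (I ⊕ P) × (Σ J, Q J) :=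
    fun u => (⟨u.1, (e u.1).symm u.2.1.1⟩,
      Sum.inr (φ.symm ((u.2.1.2.2.1, u.2.2.1), u.2.1.2.1, u.2.2.2.1)),
      ⟨u.1, (e u.1).symm u.2.2.2.2.2⟩)
  have hsub : (B.toVRA φ e).trans ⊆ F '' (Set.univ ×ˢ B.intTrans) ∪
      H '' (Set.univ ×ˢ (B.callTrans ×ˢ B.retTrans)) := by
    rintro _ ⟨J, q, x, p, hp, rfl⟩
    cases x with
    | inl a =>
      refine .inl ⟨(J, (e J q, a, e J p)), ⟨trivial, hp⟩, ?_⟩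
      simp [F]
    | inr K =>
      obtain ⟨g, hc, hr⟩ := hp
      refine .inr ⟨(J, _, _), ⟨trivial, hc, hr⟩, ?_⟩
      simp [H]
  have htrans : (B.toVRA φ e).trans.ncard ≤
      Nat.card (Option P) * (B.intTrans.ncard + B.callTrans.ncard * B.retTrans.ncard) := by
    calc _ ≤ _ := Set.ncard_le_ncard hsub (Set.toFinite _)
      _ ≤ _ := Set.ncard_union_le _ _
      _ ≤ (Set.univ ×ˢ B.intTrans : Set (Option P × _)).ncard +
          (Set.univ ×ˢ (B.callTrans ×ˢ B.retTrans) : Set (Option P × _)).ncard :=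
        add_le_add (Set.ncard_image_le (Set.toFinite _)) (Set.ncard_image_le (Set.toFinite _))
      _ = _ := by
        simp only [Set.ncard_prod, Set.ncard_univ]
        ring
  unfold VRA.size
  rw [hstate]
  set n := B.size with hn
  have hb : Nat.card S + (B.intTrans.ncard + B.callTrans.ncard * B.retTrans.ncard) ≤ 2 * n ^ 2 := by
    simp only [hn, VPA.size]
    have h1 : Nat.card S ≤ Nat.card S ^ 2 := Nat.le_self_pow (by norm_num) _
    have h2 : B.intTrans.ncard ≤ B.intTrans.ncard ^ 2 := Nat.le_self_pow (by norm_num) _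
    nlinarith [Nat.zero_le (Nat.card S * (B.intTrans.ncard + B.callTrans.ncard + B.retTrans.ncard)),
      Nat.zero_le (B.intTrans.ncard * (B.callTrans.ncard + B.retTrans.ncard)),
      Nat.zero_le (B.callTrans.ncard * B.retTrans.ncard),
      Nat.zero_le (B.callTrans.ncard ^ 2), Nat.zero_le (B.retTrans.ncard ^ 2)]
  rcases Nat.eq_zero_or_pos n with h0 | h0
  · -- Without states there is nothing to count.
    rw [h0] at hb
    have h1 : Nat.card S = 0 := by omega
    have h2 : B.intTrans.ncard + B.callTrans.ncard * B.retTrans.ncard = 0 := by omega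
    rw [h2] at htrans
    simp only [h1]
    omega
  · have hc : Nat.card (Option P) ≤ (Nat.card C * Nat.card R + 1) * n ^ 2 := by
      rw [hP]
      have h1 : Nat.card S ^ 2 ≤ n ^ 2 := Nat.pow_le_pow_left (by simp [hn, VPA.size]) 2
      have h2 : 1 ≤ n ^ 2 := Nat.one_le_pow _ _ h0
      nlinarith [Nat.mul_le_mul_right (Nat.card C * Nat.card R) h1]
    calc _ ≤ Nat.card (Option P) * Nat.card S + Nat.card (Option P) *
          (B.intTrans.ncard + B.callTrans.ncard * B.retTrans.ncard) := by gcongr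
      _ = Nat.card (Option P) *
          (Nat.card S + (B.intTrans.ncard + B.callTrans.ncard * B.retTrans.ncard)) := by ring
      _ ≤ (Nat.card C * Nat.card R + 1) * n ^ 2 * (2 * n ^ 2) := Nat.mul_le_mul hc hb
      _ = _ := by ring

end VPA

theorem acceptedByVRA_iff_acceptedByVPA {I C R : Type*} [Finite C] [Finite R]
    (L : Language (Letter I C R)) : AcceptedByVRA L ↔ AcceptedByVPA L := by
  constructor
  · rintro ⟨P, _, Q, _, A, rfl⟩
    exact ⟨A.State, inferInstance, A.State, inferInstance, A.toVPA (Equiv.refl _),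
      A.toVPA_language _⟩
  · rintro ⟨G, _, S, _, B, rfl⟩
    -- Copies of the call and return alphabets in `Type`.
    obtain ⟨c, ⟨ec⟩⟩ := Finite.exists_equiv_fin C
    obtain ⟨r, ⟨er⟩⟩ := Finite.exists_equiv_fin R
    exact ⟨(S × S) × Fin c × Fin r, inferInstance, fun _ => S, fun _ => inferInstance, _,
      B.toVRA_language (Equiv.prodCongr (Equiv.refl _) (Equiv.prodCongr ec.symm er.symm))
        (fun _ => Equiv.refl S)⟩

/-! ### Composing transducers -/

/-- The work alphabet: a blank, a marker for the first cell of a tape, and bits. -/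
inductive Cell where
  | blank
  | mark
  | bit (b : Bool)
  deriving DecidableEq

instance : Finite Cell :=
  Finite.of_surjective (fun o : Option (Option Bool) => match o with
      | none => Cell.blank
      | some none => Cell.mark
      | some (some b) => Cell.bit b) fun c => match c with
    | .blank => ⟨none, rfl⟩
    | .mark => ⟨some none, rfl⟩
    | .bit b => ⟨some (some b), rfl⟩

/-- What a transducer with `k` work tapes does in one step, apart from changing its state: the move
of the input head, the symbols written and the moves on the work tapes, and the output. -/
abbrev Operation (k : ℕ) : Type := HeadMove × (Fin k → Cell × HeadMove) × Option Bool

/-- A configuration of a transducer with `k` work tapes without its control state. -/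
structure Data (k : ℕ) where
  inPos : ℕ
  work : Fin k → ℕ → Cell
  heads : Fin k → ℕ
  out : List Bool

namespace Data

variable {k : ℕ}

/-- The symbols under the work heads. -/
def scanned (d : Data k) : Fin k → Cell := fun t => d.work t (d.heads t)

/-- The data after an action on the input `x`. -/
def apply (x : List Bool) (d : Data k) (a : Operation k) : Data k where
  inPos := min (Transducer.moveHead a.1 d.inPos) (x.length + 1)
  work := fun t => Function.update (d.work t) (d.heads t) (a.2.1 t).1
  heads := fun t => Transducer.moveHead (a.2.1 t).2 (d.heads t)
  out := d.out ++ a.2.2.toList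

/-- The input head is on the input or its end markers, and the work heads are in the first `s`
cells. -/
def Within (x : List Bool) (s : ℕ) (d : Data k) : Prop :=
  d.inPos ≤ x.length + 1 ∧ ∀ t, d.heads t < s

end Data

/-- The action that changes nothing when the symbols `w` are scanned. -/
def idle {k : ℕ} (w : Fin k → Cell) : Operation k := (.stay, fun t => (w t, .stay), none)

theorem Data.apply_idle {k : ℕ} {x : List Bool} {d : Data k} (h : d.inPos ≤ x.length + 1) :
    d.apply x (idle d.scanned) = d := by
  simp [Data.apply, idle, Transducer.moveHead, Data.scanned, min_eq_left h]

/-- A transducer with `k` work tapes that halts with a result in `β`. -/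
structure Subroutine (k : ℕ) (β : Type) where
  State : Type
  [finState : Finite State]
  start : State
  /-- either halt with a result, or go to a new state with an action -/
  next : State → InputSymbol → (Fin k → Cell) → β ⊕ (State × Operation k)

namespace Subroutine

variable {k : ℕ} {β γ : Type}

attribute [instance] Subroutine.finState

/-- `M.RunsFrom x s q d b d'`: on input `x`, started in the state `q` with data `d`, the subroutine
halts with result `b` and data `d'`, and the work heads stay in the first `s` cells. -/
inductive RunsFrom (x : List Bool) (s : ℕ) (M : Subroutine k β) :
    M.State → Data k → β → Data k → Prop where
  | halt {q : M.State} {d : Data k} {b : β} (hd : d.Within x s)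
      (h : M.next q (Transducer.scan x d.inPos) d.scanned = .inl b) : RunsFrom x s M q d b d
  | step {q q' : M.State} {d d' : Data k} {a : Operation k} {b : β} (hd : d.Within x s)
      (h : M.next q (Transducer.scan x d.inPos) d.scanned = .inr (q', a))
      (ht : RunsFrom x s M q' (d.apply x a) b d') : RunsFrom x s M q d b d'

/-- The subroutine leads from the data `d` to the result `b` and the data `d'`, with the work heads
in the first `s` cells throughout. -/
def Runs (x : List Bool) (s : ℕ) (M : Subroutine k β) (d : Data k) (b : β) (d' : Data k) : Prop :=
  M.RunsFrom x s M.start d b d'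

theorem Runs.congr {x : List Bool} {s : ℕ} {M : Subroutine k β} {d d' d'' : Data k} {b : β}
    (h : M.Runs x s d b d') (hd : d' = d'') : M.Runs x s d b d'' :=
  hd ▸ h

theorem Runs.within_right {x : List Bool} {s : ℕ} {M : Subroutine k β} {d d' : Data k}
    {b : β} (h : M.Runs x s d b d') : d'.Within x s := by
  unfold Runs at h
  generalize M.start = q at h
  induction h with
  | halt hd _ => exact hd
  | step _ _ _ ih => exact ih

/-- One action, with a result that depends on the scanned symbols. -/
def act [Finite β] (f : InputSymbol → (Fin k → Cell) → Operation k × β) : Subroutine k β where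
  State := Option β
  start := none
  next q i w := match q with
    | none => .inr (some (f i w).2, (f i w).1)
    | some b => .inl b

theorem runs_act [Finite β] {x : List Bool} {s : ℕ}
    {f : InputSymbol → (Fin k → Cell) → Operation k × β} {d : Data k} (hd : d.Within x s)
    (hd' : (d.apply x (f (Transducer.scan x d.inPos) d.scanned).1).Within x s) :
    (act f).Runs x s d (f (Transducer.scan x d.inPos) d.scanned).2
      (d.apply x (f (Transducer.scan x d.inPos) d.scanned).1) :=
  .step hd rfl (.halt hd' rfl)

/-- Halt at once. -/
def pure (b : β) : Subroutine k β where
  State := Unit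
  start := ()
  next _ _ _ := .inl b

theorem runs_pure {x : List Bool} {s : ℕ} (b : β) {d : Data k} (hd : d.Within x s) :
    (pure b : Subroutine k β).Runs x s d b d :=
  .halt hd rfl

/-- Run `M`, and then `N b` for the result `b` of `M`. -/
def bind [Finite β] (M : Subroutine k β) (N : β → Subroutine k γ) : Subroutine k γ where
  State := M.State ⊕ Σ b, (N b).State
  start := .inl M.start
  next q i w := match q with
    | .inl q => match M.next q i w with
      | .inl b => .inr (.inr ⟨b, (N b).start⟩, idle w)
      | .inr (q', a) => .inr (.inl q', a)
    | .inr ⟨b, q⟩ => match (N b).next q i w with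
      | .inl c => .inl c
      | .inr (q', a) => .inr (.inr ⟨b, q'⟩, a)

theorem Runs.bind [Finite β] {x : List Bool} {s : ℕ} {M : Subroutine k β}
    {N : β → Subroutine k γ} {d d' d'' : Data k} {b : β} {c : γ}
    (hM : M.Runs x s d b d') (hN : (N b).Runs x s d' c d'') :
    (M.bind N).Runs x s d c d'' := by
  have hright : (M.bind N).RunsFrom x s (.inr ⟨b, (N b).start⟩) d' c d'' := by
    unfold Runs at hN
    clear hM
    generalize (N b).start = q at hN
    induction hN with
    | halt hd h => exact .halt hd (by simp [Subroutine.bind, h])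
    | @step q q' d d' a c hd h _ ih =>
      have h' : (M.bind N).next (Sum.inr ⟨b, q⟩) (Transducer.scan x d.inPos) d.scanned =
          .inr (Sum.inr ⟨b, q'⟩, a) := by
        simp [Subroutine.bind, h]
      exact .step hd h' ih
  unfold Runs at hM ⊢
  change (M.bind N).RunsFrom x s (.inl M.start) d c d''
  generalize M.start = q at hM
  induction hM with
  | @halt q d b hd h =>
    have h' : (M.bind N).next (Sum.inl q) (Transducer.scan x d.inPos) d.scanned =
        .inr (Sum.inr ⟨b, (N b).start⟩, idle d.scanned) := by
      simp [Subroutine.bind, h]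
    refine .step hd h' ?_
    rw [Data.apply_idle hd.1]
    exact hright
  | @step q q' d d' a b hd h _ ih =>
    have h' : (M.bind N).next (Sum.inl q) (Transducer.scan x d.inPos) d.scanned =
        .inr (Sum.inl q', a) := by
      simp [Subroutine.bind, h]
    exact .step hd h' (ih hN hright)

/-- Run `M`, and then `N`. -/
def seq (M : Subroutine k Unit) (N : Subroutine k γ) : Subroutine k γ := M.bind fun _ => N

theorem Runs.seq {x : List Bool} {s : ℕ} {M : Subroutine k Unit}
    {N : Subroutine k γ} {d d' d'' : Data k} {c : γ}
    (hM : M.Runs x s d () d') (hN : N.Runs x s d' c d'') : (M.seq N).Runs x s d c d'' :=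
  hM.bind hN

/-- Run `M` until it gives a result other than `none`. -/
def loop (M : Subroutine k (Option β)) : Subroutine k β where
  State := M.State
  start := M.start
  next q i w := match M.next q i w with
    | .inl none => .inr (M.start, idle w)
    | .inl (some b) => .inl b
    | .inr (q', a) => .inr (q', a)

theorem Runs.loop_some {x : List Bool} {s : ℕ} {M : Subroutine k (Option β)} {d d' : Data k} {b : β}
    (h : M.Runs x s d (some b) d') : (loop M).Runs x s d b d' := by
  unfold Runs at h ⊢
  change (loop M).RunsFrom x s M.start d b d'
  generalize M.start = q at h
  generalize hb : some b = b' at h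
  induction h with
  | halt hd h => subst hb; exact .halt hd (by simp [loop, h])
  | @step q q' d d' a b hd h _ ih =>
    have h' : (loop M).next q (Transducer.scan x d.inPos) d.scanned = .inr (q', a) := by
      simp only [loop, h]
    exact .step hd h' (ih hb)

theorem Runs.loop_none {x : List Bool} {s : ℕ} {M : Subroutine k (Option β)} {d d' d'' : Data k}
    {b : β} (h : M.Runs x s d none d') (h' : (loop M).Runs x s d' b d'') :
    (loop M).Runs x s d b d'' := by
  unfold Runs at h ⊢
  change (loop M).RunsFrom x s M.start d b d''
  generalize M.start = q at h
  generalize hb : none = b' at h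
  induction h with
  | @halt q d _ hd h =>
    subst hb
    have h₁ : (loop M).next q (Transducer.scan x d.inPos) d.scanned =
        .inr (M.start, idle d.scanned) := by
      simp only [loop, h]
    refine .step hd h₁ ?_
    rw [Data.apply_idle hd.1]
    exact h'
  | @step q q' d d' a b hd h _ ih =>
    have h₁ : (loop M).next q (Transducer.scan x d.inPos) d.scanned = .inr (q', a) := by
      simp only [loop, h]
    exact .step hd h₁ (ih h' hb)

/-- The transducer that halts when the subroutine does. -/
def toTransducer (M : Subroutine k Unit) : Transducer where
  State := M.State
  Sym := Cell
  blank := .blank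
  start := M.start
  tapes := k
  next q i w := match M.next q i w with
    | .inl _ => none
    | .inr (q', a) => some (q', a)

theorem Runs.computesInSpace {x y : List Bool} {s : ℕ} {M : Subroutine k Unit} {d : Data k}
    (h : M.Runs x s ⟨0, fun _ _ => .blank, fun _ => 0, []⟩ () d) (hy : d.out = y) :
    M.toTransducer.ComputesInSpace x y s := by
  let conf : M.State → Data k → M.toTransducer.Config := fun q d =>
    ⟨q, d.inPos, d.work, d.heads, d.out⟩
  have hhalt : ∀ q (d : Data k) b, M.next q (Transducer.scan x d.inPos) d.scanned = .inl b →
      M.toTransducer.step x (conf q d) = none := by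
    intro q d b h
    simp only [Transducer.step, toTransducer, conf]
    change Option.map _ (match M.next q (Transducer.scan x d.inPos) d.scanned with
      | .inl _ => none
      | .inr (q', a) => some (q', a)) = none
    rw [h]
    rfl
  have hstep : ∀ q (d : Data k) q' a,
      M.next q (Transducer.scan x d.inPos) d.scanned = .inr (q', a) →
      M.toTransducer.step x (conf q d) = some (conf q' (d.apply x a)) := by
    intro q d q' a h
    simp only [Transducer.step, toTransducer, conf]
    change Option.map _ (match M.next q (Transducer.scan x d.inPos) d.scanned with
      | .inl _ => none
      | .inr (q', a) => some (q', a)) = _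
    rw [h]
    rfl
  suffices H : ∀ q d₀, M.RunsFrom x s q d₀ () d →
      (∃ κ, StateTransition.Reaches (M.toTransducer.step x) (conf q d₀) κ ∧
        M.toTransducer.step x κ = none ∧ κ.out = y) ∧
      ∀ κ, StateTransition.Reaches (M.toTransducer.step x) (conf q d₀) κ → ∀ t, κ.heads t < s from
    H _ _ h
  intro q d₀ hrun
  clear h
  generalize () = u at hrun
  induction hrun with
  | halt hd h =>
    refine ⟨⟨_, .refl, hhalt _ _ _ h, hy⟩, fun κ hκ => ?_⟩
    rcases Relation.ReflTransGen.cases_head hκ with rfl | ⟨κ', h', -⟩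
    · exact hd.2
    · rw [hhalt _ _ _ h] at h'
      cases h'
  | step hd h _ ih =>
    obtain ⟨⟨κ, hκ, hκ'⟩, hall⟩ := ih hy
    refine ⟨⟨κ, .head (hstep _ _ _ _ h) hκ, hκ'⟩, fun κ hκ => ?_⟩
    rcases Relation.ReflTransGen.cases_head hκ with rfl | ⟨κ', h', hκ⟩
    · exact hd.2
    · rw [hstep _ _ _ _ h] at h'
      cases h'
      exact hall κ hκ

end Subroutine

/-! ### Binary counters on work tapes -/

/-- A work tape that holds the word `l`, behind the marker in its first cell. -/
def cells (l : List Bool) : ℕ → Cell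
  | 0 => .mark
  | j + 1 => l[j]?.elim .blank .bit

theorem cells_succ_ne_mark (l : List Bool) (j : ℕ) : cells l (j + 1) ≠ .mark := by
  rw [cells]
  cases l[j]? <;> simp

theorem cells_append_cons (l₁ : List Bool) (b : Bool) (l₂ : List Bool) :
    cells (l₁ ++ b :: l₂) (l₁.length + 1) = .bit b := by
  simp [cells]

theorem cells_length (l : List Bool) : cells l (l.length + 1) = .blank := by
  simp [cells]

theorem update_cells_cons (l₁ : List Bool) (a b : Bool) (l₂ : List Bool) :
    Function.update (cells (l₁ ++ a :: l₂)) (l₁.length + 1) (.bit b) = cells (l₁ ++ b :: l₂) := by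
  funext j
  rcases j with _ | j
  · simp [cells]
  · by_cases h : j = l₁.length
    · subst h
      simp [cells]
    · rw [Function.update_of_ne (by omega)]
      simp only [cells]
      congr 1
      grind

theorem update_cells_bit (l : List Bool) (b : Bool) :
    Function.update (cells l) (l.length + 1) (.bit b) = cells (l ++ [b]) := by
  funext j
  rcases j with _ | j
  · simp [cells]
  · by_cases h : j = l.length
    · subst h
      simp [cells]
    · rw [Function.update_of_ne (by omega)]
      simp only [cells]
      congr 1
      grind

theorem update_cells_blank (l : List Bool) (b : Bool) :
    Function.update (cells (l ++ [b])) (l.length + 1) .blank = cells l := by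
  rw [← update_cells_bit, Function.update_idem, Function.update_eq_self_iff, cells_length]

/-- The successor of a number in binary, least significant bit first. -/
def succBits : List Bool → List Bool
  | [] => [true]
  | false :: l => true :: l
  | true :: l => false :: succBits l

theorem bits_succ (n : ℕ) : (n + 1).bits = succBits n.bits := by
  induction n using Nat.strong_induction_on with
  | _ n ih =>
    obtain ⟨m, rfl | rfl⟩ := Nat.even_or_odd' n
    · rcases Nat.eq_zero_or_pos m with rfl | hm
      · simp [succBits]
      · rw [Nat.bit0_bits m hm.ne', Nat.bit1_bits, succBits]
    · rw [Nat.bit1_bits, succBits, ← ih m (by omega), ← Nat.bit0_bits _ (by omega)]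
      ring_nf

theorem bits_injective : Function.Injective Nat.bits := by
  intro m n h
  refine Nat.eq_of_testBit_eq fun i => ?_
  rw [Nat.testBit_eq_inth, Nat.testBit_eq_inth, h]

/-- The data with the contents and the head position of the tape `t` replaced. -/
def Data.setTape {k : ℕ} (d : Data k) (t : Fin k) (T : ℕ → Cell) (h : ℕ) : Data k :=
  { d with work := Function.update d.work t T, heads := Function.update d.heads t h }

theorem Data.Within.setTape {k : ℕ} {x : List Bool} {s : ℕ} {d : Data k} (hd : d.Within x s)
    (t : Fin k) (T : ℕ → Cell) {h : ℕ} (hh : h < s) : (d.setTape t T h).Within x s := by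
  refine ⟨hd.1, fun u => ?_⟩
  simp only [Data.setTape, Function.update_apply]
  split_ifs
  · exact hh
  · exact hd.2 u

theorem Data.setTape_self {k : ℕ} (d : Data k) (t : Fin k) :
    d.setTape t (d.work t) (d.heads t) = d := by
  simp [Data.setTape]

namespace Subroutine

variable {k : ℕ} {β : Type} {x : List Bool} {s : ℕ}

/-- One action on the tape `t`, which depends on the symbol scanned there. -/
def onTape [Finite β] (t : Fin k) (f : Cell → (Cell × HeadMove) × β) : Subroutine k β :=
  act fun _ w => ((.stay, fun u => if u = t then (f (w t)).1 else (w u, .stay), none), (f (w t)).2)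

theorem runs_onTape [Finite β] {t : Fin k} {f : Cell → (Cell × HeadMove) × β} {d : Data k}
    {T : ℕ → Cell} {h : ℕ} {c : Cell} {m : HeadMove} {b : β} (hf : f (T h) = ((c, m), b))
    (hd : d.Within x s) (hh : h < s) (hh' : Transducer.moveHead m h < s) :
    (onTape t f).Runs x s (d.setTape t T h) b
      (d.setTape t (Function.update T h c) (Transducer.moveHead m h)) := by
  have hT : (d.setTape t T h).scanned t = T h := by simp [Data.scanned, Data.setTape]
  have happ : (d.setTape t T h).apply x (.stay, fun u => if u = t then (f (T h)).1 else
      ((d.setTape t T h).scanned u, .stay), none) =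
      d.setTape t (Function.update T h c) (Transducer.moveHead m h) := by
    have h1 : d.inPos ≤ x.length + 1 := hd.1
    simp only [Data.apply, Data.setTape, Data.scanned, hf, Option.toList_none, List.append_nil,
      Transducer.moveHead, min_eq_left h1, Data.mk.injEq, true_and, and_true]
    constructor
    · funext u
      by_cases hu : u = t
      · subst hu
        simp
      · simp [hu]
    · funext u
      by_cases hu : u = t
      · subst hu
        simp
      · simp [hu]
  have := runs_act (x := x) (s := s) (d := d.setTape t T h) (f := fun (_ : InputSymbol) w =>
    (((.stay, fun u => if u = t then (f (w t)).1 else (w u, .stay), none) : Operation k),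
      (f (w t)).2)) (hd.setTape t T hh)
  simp only [hT] at this
  rw [happ, hf] at this
  exact this (hd.setTape t _ hh')

/-- Move the head of the tape `t` back to the first cell. -/
def rewind (t : Fin k) : Subroutine k Unit :=
  loop <| onTape t fun c => if c = .mark then ((c, .stay), some ()) else ((c, .left), none)

theorem runs_rewind_setTape {t : Fin k} {d : Data k} (hd : d.Within x s) {T : ℕ → Cell} {h : ℕ}
    (hh : h < s) (h₀ : T 0 = .mark) (h₁ : ∀ j, T (j + 1) ≠ .mark) :
    (rewind t).Runs x s (d.setTape t T h) () (d.setTape t T 0) := by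
  induction h with
  | zero =>
    refine Runs.loop_some ?_
    have := runs_onTape (t := t) (T := T) (h := 0)
      (f := fun c => if c = .mark then ((c, .stay), some ()) else ((c, .left), none))
      (if_pos h₀) hd hh hh
    rwa [Function.update_eq_self] at this
  | succ j ih =>
    refine Runs.loop_none ?_ (ih (by omega))
    have := runs_onTape (t := t) (T := T) (h := j + 1)
      (f := fun c => if c = .mark then ((c, .stay), some ()) else ((c, .left), none))
      (if_neg (h₁ j)) hd hh (by simp only [Transducer.moveHead]; omega)
    rwa [Function.update_eq_self] at this

theorem runs_rewind {t : Fin k} {d : Data k} (hd : d.Within x s) {l : List Bool}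
    (hl : d.work t = cells l) :
    (rewind t).Runs x s d () { d with heads := Function.update d.heads t 0 } := by
  have := runs_rewind_setTape (t := t) (T := d.work t) hd (hd.2 t) (h₀ := by rw [hl]; rfl)
    (h₁ := fun j => by rw [hl]; exact cells_succ_ne_mark l j)
  rw [Data.setTape_self] at this
  simpa [Data.setTape] using this

/-- Increment the binary counter on the tape `t`: the carry turns ones into zeros up to the first
zero or blank, which becomes a one. -/
def inc (t : Fin k) : Subroutine k Unit :=
  (onTape t fun c => ((c, .right), ())).seq <|
    (loop <| onTape t fun c => if c = .bit true then ((.bit false, .right), none)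
      else ((.bit true, .stay), some ())).seq <|
    rewind t

theorem runs_inc_setTape {t : Fin k} {d : Data k} (hd : d.Within x s) {l : List Bool}
    (hl : (succBits l).length < s) :
    (inc t).Runs x s (d.setTape t (cells l) 0) () (d.setTape t (cells (succBits l)) 0) := by
  have key : ∀ (l₂ l₁ : List Bool), (l₁ ++ succBits l₂).length < s →
      ∃ h < s, (loop <| onTape t fun c => if c = .bit true then ((.bit false, .right), none)
          else ((.bit true, .stay), some ())).Runs x s
        (d.setTape t (cells (l₁ ++ l₂)) (l₁.length + 1)) ()
        (d.setTape t (cells (l₁ ++ succBits l₂)) h) := by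
    intro l₂
    induction l₂ with
    | nil =>
      intro l₁ hl₁
      refine ⟨l₁.length + 1, by simpa [succBits] using hl₁, Runs.loop_some ?_⟩
      rw [List.append_nil, succBits, ← update_cells_bit]
      have hlen : l₁.length + 1 < s := by simpa [succBits] using hl₁
      refine runs_onTape (m := .stay) (if_neg ?_) hd hlen hlen
      rw [cells_length]
      simp
    | cons b l₂ ih =>
      intro l₁ hl₁
      have hlen : l₁.length + 1 < s := by
        refine lt_of_le_of_lt ?_ hl₁
        cases b <;> simp [succBits]
      cases b with
      | false =>
        refine ⟨l₁.length + 1, hlen, Runs.loop_some ?_⟩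
        rw [succBits, ← update_cells_cons l₁ false true]
        refine runs_onTape (m := .stay) (if_neg ?_) hd hlen hlen
        rw [cells_append_cons]
        simp
      | true =>
        have hlen' : l₁.length + 1 + 1 < s := by
          refine lt_of_le_of_lt ?_ hl₁
          have : 1 ≤ (succBits l₂).length := by
            rcases l₂ with _ | ⟨_ | _, l₂⟩ <;> simp [succBits]
          simp [succBits]
          omega
        obtain ⟨h, hh, hrun⟩ := ih (l₁ ++ [false]) (by simpa [succBits] using hl₁)
        refine ⟨h, hh, Runs.loop_none ?_ (by simpa [succBits] using hrun)⟩
        have := runs_onTape (t := t) (T := cells (l₁ ++ true :: l₂)) (h := l₁.length + 1)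
          (f := fun c => if c = .bit true then ((.bit false, .right), none)
            else ((.bit true, .stay), some ()))
          (if_pos (cells_append_cons l₁ true l₂)) hd hlen hlen'
        rw [update_cells_cons] at this
        simpa [Transducer.moveHead] using this
  obtain ⟨h, hh, hrun⟩ := key l [] hl
  have h1 : 1 ≤ (succBits l).length := by
    rcases l with _ | ⟨_ | _, l⟩ <;> simp [succBits]
  refine Runs.seq (d' := d.setTape t (cells l) 1) ?_ (Runs.seq hrun
    (runs_rewind_setTape hd hh rfl fun j => cells_succ_ne_mark _ j))
  have := runs_onTape (t := t) (T := cells l) (h := 0) (f := fun c => ((c, .right), ())) rfl hd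
    (by omega) (by simp only [Transducer.moveHead]; omega)
  rwa [Function.update_eq_self] at this

/-- Erase the word on the tape `t`, moving to its end and erasing on the way back. -/
def reset (t : Fin k) : Subroutine k Unit :=
  (onTape t fun c => ((c, .right), ())).seq <|
    (loop <| onTape t fun c => if c = .blank then ((c, .left), some ())
      else ((c, .right), none)).seq <|
    (loop <| onTape t fun c => if c = .mark then ((c, .stay), some ())
      else ((.blank, .left), none))

theorem runs_reset_setTape {t : Fin k} {d : Data k} (hd : d.Within x s) {l : List Bool}
    (hl : l.length + 1 < s) :
    (reset t).Runs x s (d.setTape t (cells l) 0) () (d.setTape t (cells []) 0) := by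
  have hskip : ∀ l₂ l₁ : List Bool, (l₁ ++ l₂).length + 1 < s →
      (loop <| onTape t fun c => if c = .blank then ((c, .left), some ())
        else ((c, .right), none)).Runs x s (d.setTape t (cells (l₁ ++ l₂)) (l₁.length + 1)) ()
        (d.setTape t (cells (l₁ ++ l₂)) (l₁ ++ l₂).length) := by
    intro l₂
    induction l₂ with
    | nil =>
      intro l₁ hl₁
      rw [List.append_nil] at hl₁ ⊢
      refine Runs.loop_some ?_
      have := runs_onTape (t := t) (T := cells l₁) (h := l₁.length + 1)
        (f := fun c => if c = .blank then ((c, .left), some ()) else ((c, .right), none))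
        (if_pos (cells_length l₁)) hd hl₁ (by simp only [Transducer.moveHead]; omega)
      rwa [Function.update_eq_self] at this
    | cons b l₂ ih =>
      intro l₁ hl₁
      have := ih (l₁ ++ [b]) (by simpa using hl₁)
      rw [List.append_assoc, List.singleton_append] at this
      refine Runs.loop_none ?_ this
      have := runs_onTape (t := t) (T := cells (l₁ ++ b :: l₂)) (h := l₁.length + 1)
        (f := fun c => if c = .blank then ((c, .left), some ()) else ((c, .right), none))
        (if_neg (by rw [cells_append_cons]; simp)) hd (by simp at hl₁; omega)
        (by simp only [Transducer.moveHead]; simp at hl₁; omega)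
      rw [Function.update_eq_self] at this
      simpa [Transducer.moveHead] using this
  have herase : ∀ l : List Bool, l.length + 1 < s →
      (loop <| onTape t fun c => if c = .mark then ((c, .stay), some ())
        else ((.blank, .left), none)).Runs x s (d.setTape t (cells l) l.length) ()
        (d.setTape t (cells []) 0) := by
    intro l
    induction l using List.reverseRecOn with
    | nil =>
      intro hl
      refine Runs.loop_some ?_
      have := runs_onTape (t := t) (T := cells []) (h := 0)
        (f := fun c => if c = .mark then ((c, .stay), some ()) else ((.blank, .left), none))
        (if_pos rfl) hd (by omega) (by simp only [Transducer.moveHead]; omega)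
      rwa [Function.update_eq_self] at this
    | append_singleton l b ih =>
      intro hl
      rw [List.length_append, List.length_singleton] at hl ⊢
      refine Runs.loop_none ?_ (ih (by omega))
      have := runs_onTape (t := t) (T := cells (l ++ [b])) (h := l.length + 1)
        (f := fun c => if c = .mark then ((c, .stay), some ()) else ((.blank, .left), none))
        (if_neg (cells_succ_ne_mark _ _)) hd (by omega)
        (by simp only [Transducer.moveHead]; omega)
      rw [update_cells_blank] at this
      exact this
  refine Runs.seq (d' := d.setTape t (cells l) 1) ?_ (Runs.seq (hskip l [] hl) (herase l hl))
  have := runs_onTape (t := t) (T := cells l) (h := 0) (f := fun c => ((c, .right), ())) rfl hd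
    (by omega) (by simp only [Transducer.moveHead]; omega)
  rwa [Function.update_eq_self] at this

/-- Move the heads of the tapes `t` and `u` to the right as long as they scan the same symbol other
than a blank; the result tells whether they then scan the same symbol. -/
def compare (t u : Fin k) : Subroutine k Bool :=
  loop <| act fun _ w => if w t = w u ∧ w t ≠ .blank
    then ((.stay, fun v => (w v, if v = t ∨ v = u then .right else .stay), none), none)
    else (idle w, some (w t = w u))

/-- Test whether the tapes `t` and `u` hold the same word. -/
def eqTest (t u : Fin k) : Subroutine k Bool :=
  (compare t u).bind fun b => (rewind t).seq <| (rewind u).seq <| pure b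

theorem runs_eqTest {t u : Fin k} {d : Data k} (hd : d.Within x s) {l m : List Bool}
    (ht : d.work t = cells l) (hu : d.work u = cells m) (hht : d.heads t = 0) (hhu : d.heads u = 0)
    (hl : l.length + 1 < s) :
    (eqTest t u).Runs x s d (decide (l = m)) d := by
  -- The data during the comparison, with both heads in the cell `h`.
  let D : ℕ → Data k := fun h => { d with heads := fun v => if v = t ∨ v = u then h else d.heads v }
  have hD : ∀ h < s, (D h).Within x s := fun h hh => ⟨hd.1, fun v => by
    simp only [D]
    split_ifs
    · exact hh
    · exact hd.2 v⟩
  have hscan : ∀ h, (D h).scanned t = cells l h ∧ (D h).scanned u = cells m h := fun h => by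
    simp [D, Data.scanned, ht, hu]
  have hmove : ∀ h, h + 1 < s → cells l h = cells m h → cells l h ≠ .blank →
      ∀ {b d'}, (compare t u).Runs x s (D (h + 1)) b d' → (compare t u).Runs x s (D h) b d' := by
    intro h hh h1 h2 b d' hrun
    refine Runs.loop_none (d' := D (h + 1)) ?_ hrun
    have happ : (D h).apply x (.stay, fun v => ((D h).scanned v,
        if v = t ∨ v = u then .right else .stay), none) = D (h + 1) := by
      have h0 : d.inPos ≤ x.length + 1 := hd.1
      simp only [D, Data.apply, Data.scanned, Function.update_eq_self, Transducer.moveHead,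
        Option.toList_none, List.append_nil, min_eq_left h0, Data.mk.injEq, true_and, and_true]
      funext v
      split_ifs <;> rfl
    have := runs_act (x := x) (s := s) (d := D h)
      (f := fun (_ : InputSymbol) (w : Fin k → Cell) => if w t = w u ∧ w t ≠ .blank
        then (((.stay, fun v => (w v, if v = t ∨ v = u then .right else .stay), none) :
          Operation k), (none : Option Bool))
        else (idle w, some (decide (w t = w u)))) (hD h (by omega))
    rw [if_pos (by rw [(hscan h).1, (hscan h).2]; exact ⟨h1, h2⟩)] at this
    rw [happ] at this
    exact this (hD _ hh)
  have hdiff : ∀ h < s, ¬ (cells l h = cells m h ∧ cells l h ≠ .blank) →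
      (compare t u).Runs x s (D h) (decide (cells l h = cells m h)) (D h) := by
    intro h hh h1
    refine Runs.loop_some ?_
    have := runs_act (x := x) (s := s) (d := D h)
      (f := fun (_ : InputSymbol) (w : Fin k → Cell) => if w t = w u ∧ w t ≠ .blank
        then (((.stay, fun v => (w v, if v = t ∨ v = u then .right else .stay), none) :
          Operation k), (none : Option Bool))
        else (idle w, some (decide (w t = w u)))) (hD h hh)
    rw [if_neg (by rw [(hscan h).1, (hscan h).2]; exact h1)] at this
    rw [Data.apply_idle (hD h hh).1] at this
    rw [(hscan h).1, (hscan h).2] at this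
    exact this (hD _ hh)
  have hcompare : ∀ l' m' pre : List Bool, l = pre ++ l' → m = pre ++ m' →
      ∃ h < s, (compare t u).Runs x s (D (pre.length + 1)) (decide (l' = m')) (D h) := by
    intro l'
    induction l' with
    | nil =>
      intro m' pre hpl hpm
      have hlen : pre.length + 1 < s := by simpa [hpl] using hl
      refine ⟨_, hlen, ?_⟩
      have h1 : cells l (pre.length + 1) = .blank := by
        rw [hpl, List.append_nil, cells_length]
      have := hdiff _ hlen (by rw [h1]; simp)
      rw [h1] at this
      convert this using 2
      rcases m' with _ | ⟨b, m'⟩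
      · simp [hpm, cells_length]
      · simp [hpm, cells_append_cons]
    | cons a l' ih =>
      intro m' pre hpl hpm
      have hlen : pre.length + 1 + 1 < s := by simp [hpl] at hl; omega
      have h1 : cells l (pre.length + 1) = .bit a := by rw [hpl, cells_append_cons]
      rcases m' with _ | ⟨b, m'⟩
      · have h2 : cells m (pre.length + 1) = .blank := by rw [hpm, List.append_nil, cells_length]
        refine ⟨pre.length + 1, by omega, ?_⟩
        have := hdiff (pre.length + 1) (by omega) (by rw [h1, h2]; simp)
        rw [h1, h2] at this
        simpa using this
      · have h2 : cells m (pre.length + 1) = .bit b := by rw [hpm, cells_append_cons]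
        by_cases hab : a = b
        · subst hab
          obtain ⟨h, hh, hrun⟩ := ih m' (pre ++ [a]) (by simp [hpl]) (by simp [hpm])
          refine ⟨h, hh, hmove _ hlen (by rw [h1, h2]) (by rw [h1]; simp) ?_⟩
          simpa using hrun
        · refine ⟨pre.length + 1, by omega, ?_⟩
          have := hdiff (pre.length + 1) (by omega) (by rw [h1, h2]; simp [hab])
          rw [h1, h2] at this
          simpa [hab] using this
  obtain ⟨h, hh, hrun⟩ := hcompare l m [] rfl rfl
  have hD0 : D 0 = d := by
    simp only [D]
    congr 1
    funext v
    split_ifs with hv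
    · rcases hv with rfl | rfl
      · exact hht.symm
      · exact hhu.symm
    · rfl
  have hrun' : (compare t u).Runs x s d (decide (l = m)) (D h) := by
    rw [← hD0]
    exact hmove 0 (by simp only [List.length_nil] at *; omega) rfl (by simp [cells]) hrun
  have hr1 := runs_rewind (t := t) (hD h hh) ht
  have hr2 := runs_rewind (t := u) hr1.within_right (l := m) hu
  have hfin : ({ (D h) with
      heads := Function.update (Function.update (D h).heads t 0) u 0 } : Data k) = d := by
    simp only [D]
    congr 1
    funext v
    by_cases hvt : v = t
    · subst hvt
      by_cases hvu : v = u
      · simp [hvu, ← hhu]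
      · simp [hvu, hht]
    · by_cases hvu : v = u
      · simp [hvu, hhu]
      · simp [hvt, hvu]
  refine hrun'.bind (hr1.seq (hr2.seq ?_))
  convert runs_pure (decide (l = m)) hd using 1

/-! ### Environments -/

/-- The data in which the tapes hold the numbers in the list `ρ` in binary, the other tapes being
empty, and all work heads are in the first cell. -/
def mem (ρ : List ℕ) (p : ℕ) (o : List Bool) : Data k where
  inPos := p
  work := fun t => cells (ρ.getD t 0).bits
  heads := fun _ => 0
  out := o

theorem mem_append_singleton {ρ : List ℕ} {t : Fin k} (ht : t.val = ρ.length) (m p : ℕ)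
    (o : List Bool) :
    (mem (ρ ++ [m]) p o : Data k) = (mem ρ p o).setTape t (cells m.bits) 0 := by
  simp only [mem, Data.setTape, Function.update_eq_self, Data.mk.injEq, true_and, and_true]
  funext u
  by_cases hu : u = t
  · subst hu
    simp [ht]
  · have : u.val ≠ ρ.length := fun h => hu (Fin.ext (h.trans ht.symm))
    rw [Function.update_of_ne hu]
    congr 2
    grind

/-- A tape that is not in use is a counter with the value `0`. -/
theorem mem_append_zero (ρ : List ℕ) (p : ℕ) (o : List Bool) :
    (mem (ρ ++ [0]) p o : Data k) = mem ρ p o := by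
  simp only [mem, Data.mk.injEq, true_and, and_true]
  funext u
  congr 2
  grind

theorem within_mem {ρ : List ℕ} {p : ℕ} {o : List Bool} (hp : p ≤ x.length + 1) (hs : 0 < s) :
    (mem ρ p o : Data k).Within x s :=
  ⟨hp, fun _ => hs⟩

theorem runs_inc {ρ : List ℕ} {t : Fin k} (ht : t.val = ρ.length) {m p : ℕ} (o : List Bool)
    (hp : p ≤ x.length + 1) (hs : (m + 1).size < s) :
    (inc t).Runs x s (mem (ρ ++ [m]) p o) () (mem (ρ ++ [m + 1]) p o) := by
  rw [mem_append_singleton ht, mem_append_singleton ht, bits_succ]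
  exact runs_inc_setTape (within_mem hp (by omega))
    (by rwa [← bits_succ, Nat.size_eq_bits_len])

theorem runs_reset {ρ : List ℕ} {t : Fin k} (ht : t.val = ρ.length) {m p : ℕ} (o : List Bool)
    (hp : p ≤ x.length + 1) (hs : m.size + 1 < s) :
    (reset t).Runs x s (mem (ρ ++ [m]) p o) () (mem ρ p o) := by
  rw [← mem_append_zero ρ, mem_append_singleton ht, mem_append_singleton ht, Nat.zero_bits]
  exact runs_reset_setTape (within_mem hp (by omega)) (by rwa [Nat.size_eq_bits_len])

theorem runs_eqTest_mem {ρ : List ℕ} {t u : Fin k} {p : ℕ} (o : List Bool)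
    (hp : p ≤ x.length + 1) (ht : (ρ.getD t 0).size + 1 < s) :
    (eqTest t u).Runs x s (mem ρ p o) (decide (ρ.getD t 0 = ρ.getD u 0)) (mem ρ p o) := by
  have := runs_eqTest (x := x) (s := s) (d := mem ρ p o) (t := t) (u := u)
    (within_mem hp (by omega)) rfl rfl rfl rfl (by rwa [Nat.size_eq_bits_len])
  simpa only [bits_injective.eq_iff] using this

/-! ### Input and output -/

/-- Move the input head, with a result that depends on the scanned symbol, and write output. -/
def inOut [Finite β] (f : InputSymbol → HeadMove × Option Bool × β) : Subroutine k β :=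
  act fun i w => (((f i).1, fun t => (w t, .stay), (f i).2.1), (f i).2.2)

theorem runs_inOut [Finite β] {f : InputSymbol → HeadMove × Option Bool × β} {ρ : List ℕ} {p : ℕ}
    {o : List Bool} {m : HeadMove} {c : Option Bool} {b : β}
    (hf : f (Transducer.scan x p) = (m, c, b)) (hp : p ≤ x.length + 1) (hs : 0 < s) :
    (inOut f : Subroutine k β).Runs x s (mem ρ p o) b
      (mem ρ (min (Transducer.moveHead m p) (x.length + 1)) (o ++ c.toList)) := by
  have := runs_act (x := x) (s := s) (d := (mem ρ p o : Data k))
    (f := fun i w => (((f i).1, fun t => (w t, .stay), (f i).2.1), (f i).2.2)) (within_mem hp hs)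
  have happ : (mem ρ p o : Data k).apply x
      (m, fun t => ((mem ρ p o : Data k).scanned t, .stay), c) =
      mem ρ (min (Transducer.moveHead m p) (x.length + 1)) (o ++ c.toList) := by
    simp [Data.apply, mem, Data.scanned, Transducer.moveHead]
  have hin : (mem ρ p o : Data k).inPos = p := rfl
  simp only [hin, hf, happ] at this
  exact this (within_mem (min_le_right _ _) hs)

/-- Move the input head to the left end marker. -/
def rewindInput : Subroutine k Unit :=
  loop <| inOut fun i => match i with
    | .leftEnd => (.stay, none, some ())
    | _ => (.left, none, none)

theorem runs_rewindInput {ρ : List ℕ} {p : ℕ} (o : List Bool) (hp : p ≤ x.length + 1) (hs : 0 < s) :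
    (rewindInput : Subroutine k Unit).Runs x s (mem ρ p o) () (mem ρ 0 o) := by
  induction p with
  | zero =>
    refine Runs.loop_some ?_
    have := runs_inOut (k := k) (x := x) (s := s) (ρ := ρ) (p := 0) (o := o)
      (f := fun i => match i with
        | .leftEnd => (HeadMove.stay, none, some ())
        | _ => (.left, none, none)) rfl hp hs
    simpa [Transducer.moveHead] using this
  | succ p ih =>
    refine Runs.loop_none ?_ (ih (by omega))
    have := runs_inOut (k := k) (x := x) (s := s) (ρ := ρ) (p := p + 1) (o := o) (m := .left)
      (c := none) (b := none)
      (f := fun i => match i with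
        | .leftEnd => (HeadMove.stay, none, some ())
        | _ => (.left, none, none))
      (by simp only [Transducer.scan]; cases x[p]? <;> rfl) hp hs
    have h1 : min p (x.length + 1) = p := by omega
    simpa [Transducer.moveHead, h1] using this

/-- Move the input head one cell to the right. -/
def moveRight : Subroutine k Unit := inOut fun _ => (.right, none, ())

theorem runs_moveRight {ρ : List ℕ} {p : ℕ} (o : List Bool) (hp : p ≤ x.length + 1) (hs : 0 < s) :
    (moveRight : Subroutine k Unit).Runs x s (mem ρ p o) ()
      (mem ρ (min (p + 1) (x.length + 1)) o) := by
  have := runs_inOut (k := k) (x := x) (s := s) (ρ := ρ) (p := p) (o := o)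
    (f := fun _ => (HeadMove.right, none, ())) rfl hp hs
  simpa [moveRight, Transducer.moveHead] using this

/-- Test whether the input head scans a bit `1`. -/
def scanBit : Subroutine k Bool := inOut fun i => match i with
  | .bit b => (.stay, none, b)
  | _ => (.stay, none, false)

theorem runs_scanBit {ρ : List ℕ} (a : ℕ) (o : List Bool) (hs : 0 < s) :
    (scanBit : Subroutine k Bool).Runs x s (mem ρ (min (a + 1) (x.length + 1)) o) (x.getD a false)
      (mem ρ (min (a + 1) (x.length + 1)) o) := by
  have := runs_inOut (k := k) (x := x) (s := s) (ρ := ρ) (p := min (a + 1) (x.length + 1)) (o := o)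
    (m := .stay) (c := none) (b := x.getD a false)
    (f := fun i => match i with
      | .bit b => (HeadMove.stay, none, b)
      | _ => (.stay, none, false))
    (by
      rw [Nat.add_min_add_right]
      simp only [Transducer.scan]
      rcases lt_or_ge a x.length with h | h
      · simp [min_eq_left h.le, h]
      · simp [h]) (min_le_right _ _) hs
  simpa [scanBit, Transducer.moveHead] using this

/-- Write a bit. -/
def emitBit (b : Bool) : Subroutine k Unit := inOut fun _ => (.stay, some b, ())

theorem runs_emitBit {ρ : List ℕ} (b : Bool) {p : ℕ} (o : List Bool) (hp : p ≤ x.length + 1)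
    (hs : 0 < s) :
    (emitBit b : Subroutine k Unit).Runs x s (mem ρ p o) () (mem ρ p (o ++ [b])) := by
  have := runs_inOut (k := k) (x := x) (s := s) (ρ := ρ) (p := p) (o := o)
    (f := fun _ => (HeadMove.stay, some b, ())) rfl hp hs
  simpa [emitBit, Transducer.moveHead, min_eq_left hp] using this

/-- Write the marker in the first cell of every work tape. -/
def markTapes : Subroutine k Unit := act fun _ _ => ((.stay, fun _ => (.mark, .stay), none), ())

theorem runs_markTapes (hs : 0 < s) :
    (markTapes : Subroutine k Unit).Runs x s ⟨0, fun _ _ => .blank, fun _ => 0, []⟩ ()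
      (mem [] 0 []) := by
  have := runs_act (x := x) (s := s) (d := (⟨0, fun _ _ => .blank, fun _ => 0, []⟩ : Data k))
    (f := fun _ _ => (((.stay, fun _ => (.mark, .stay), none) : Operation k), ()))
    ⟨by simp, fun _ => hs⟩
  have happ : (⟨0, fun _ _ => .blank, fun _ => 0, []⟩ : Data k).apply x
      (.stay, fun _ => (.mark, .stay), none) = mem [] 0 [] := by
    simp only [Data.apply, mem, Transducer.moveHead, Data.mk.injEq]
    refine ⟨by simp, ?_, trivial, by simp⟩
    funext t j
    rcases j with _ | j <;> simp [cells]
  simp only [happ] at this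
  exact this (within_mem (by simp) hs)

end Subroutine

/-! ### Programs that write tables -/

/-- Polynomials in the variables of an environment, which compute addresses of input bits. An
environment is a list of numbers, and the variable `i` stands for its entry at the index `i`, so
that a variable keeps its number when the environment is extended. -/
inductive AddressTerm where
  | var (i : ℕ)
  | num (n : ℕ)
  | add (a b : AddressTerm)
  | mul (a b : AddressTerm)

namespace AddressTerm

instance : Add AddressTerm := ⟨add⟩
instance : Mul AddressTerm := ⟨mul⟩
instance (n : ℕ) : OfNat AddressTerm n := ⟨num n⟩

/-- The value in the environment `ρ`. -/
def eval (ρ : List ℕ) : AddressTerm → ℕ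
  | var i => ρ.getD i 0
  | num n => n
  | add a b => a.eval ρ + b.eval ρ
  | mul a b => a.eval ρ * b.eval ρ

/-- All variables have numbers less than `d`. -/
def fits (d : ℕ) : AddressTerm → Bool
  | var i => decide (i < d)
  | num _ => true
  | add a b => a.fits d && b.fits d
  | mul a b => a.fits d && b.fits d

/-- The number of nested loops needed to count up to the value. -/
def nesting : AddressTerm → ℕ
  | var _ => 1
  | num _ => 0
  | add a b => max a.nesting b.nesting
  | mul a b => a.nesting + b.nesting

theorem fits_mono {e : AddressTerm} {d d' : ℕ} (h : e.fits d) (hd : d ≤ d') : e.fits d' := by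
  induction e with
  | var i =>
    simp only [fits, decide_eq_true_eq] at h ⊢
    omega
  | num n => rfl
  | add a b iha ihb | mul a b iha ihb =>
    simp only [fits, Bool.and_eq_true] at h ⊢
    exact ⟨iha h.1, ihb h.2⟩

theorem eval_of_prefix {e : AddressTerm} {ρ ρ' : List ℕ} (h : e.fits ρ.length)
    (hρ : ρ <+: ρ') : e.eval ρ' = e.eval ρ := by
  obtain ⟨σ, rfl⟩ := hρ
  induction e with
  | var i =>
    simp only [fits, decide_eq_true_eq] at h
    simp only [eval]
    grind
  | num n => rfl
  | add a b iha ihb | mul a b iha ihb =>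
    simp only [fits, Bool.and_eq_true] at h
    simp only [eval, iha h.1, ihb h.2]

end AddressTerm

/-- Conditions on the input and the numbers in an environment. -/
inductive TableFormula where
  | tt
  | bit (e : AddressTerm)
  | eq (i j : ℕ)
  | and (φ ψ : TableFormula)
  | not (φ : TableFormula)
  | ex (i : ℕ) (φ : TableFormula)

namespace TableFormula

/-- The truth value on the input `x` in the environment `ρ`. The formula `bit e` says that the input
has a bit `1` at the address `e`, and `ex i φ` that `φ` holds for some value of the next
variable that is less than the value of the variable `i`. -/
def eval (x : List Bool) : TableFormula → List ℕ → Bool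
  | tt, _ => true
  | bit e, ρ => x.getD (e.eval ρ) false
  | eq i j, ρ => decide (ρ.getD i 0 = ρ.getD j 0)
  | and φ ψ, ρ => φ.eval x ρ && ψ.eval x ρ
  | not φ, ρ => !φ.eval x ρ
  | ex i φ, ρ => (List.range (ρ.getD i 0)).any fun m => φ.eval x (ρ ++ [m])

/-- In environments of length `d`, the formula has no free variables beyond the environment
and can be evaluated with `k` tapes. -/
def fits (k : ℕ) : TableFormula → ℕ → Bool
  | tt, _ => true
  | bit e, d => e.fits d && decide (d + e.nesting ≤ k)
  | eq i j, d => decide (i < d) && decide (j < d) && decide (d ≤ k)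
  | and φ ψ, d => φ.fits k d && ψ.fits k d
  | not φ, d => φ.fits k d
  | ex i φ, d => decide (i < d) && decide (d < k) && φ.fits k (d + 1)

end TableFormula

/-- Programs that write tables of bits. -/
inductive TableProgram where
  | emit (φ : TableFormula)
  | seq (c₁ c₂ : TableProgram)
  | loop (i : ℕ) (c : TableProgram)
  | letRun (e : AddressTerm) (c : TableProgram)

namespace TableProgram

/-- The output on the input `x` in the environment `ρ`. The program `emit φ` writes the truth value
of `φ`; `loop i c` executes `c` for all values of the next variable that are less than the value of
the variable `i`; `letRun e c` executes `c` with the next variable set to the length of the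
run of ones that starts at the address `e` of the input. -/
def eval (x : List Bool) : TableProgram → List ℕ → List Bool
  | emit φ, ρ => [φ.eval x ρ]
  | seq c₁ c₂, ρ => c₁.eval x ρ ++ c₂.eval x ρ
  | loop i c, ρ => (List.range (ρ.getD i 0)).flatMap fun m => c.eval x (ρ ++ [m])
  | letRun e c, ρ => c.eval x (ρ ++ [((x.drop (e.eval ρ)).takeWhile id).length])

end TableProgram

namespace TableProgram

/-- In environments of length `d`, the program has no free variables beyond the environment
and can be executed with `k` tapes. -/
def fits (k : ℕ) : TableProgram → ℕ → Bool
  | emit φ, d => φ.fits k d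
  | seq c₁ c₂, d => c₁.fits k d && c₂.fits k d
  | loop i c, d => decide (i < d) && decide (d < k) && c.fits k (d + 1)
  | letRun e c, d => e.fits d && decide (d < k) && decide (d + 1 + max e.nesting 1 ≤ k) &&
      c.fits k (d + 1)

end TableProgram

/-! ### Execution in logarithmic space -/

namespace Subroutine

variable {k : ℕ} [NeZero k] {β : Type} {x : List Bool} {s : ℕ}

/-- Let the counter on the tape `d`, from `0` on, count up to the number on the tape `i`, executing
`body` for each value, until `body` gives the result `true`. The result tells whether it did. -/
def search (d i : ℕ) (body : Subroutine k Bool) : Subroutine k Bool :=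
  (loop <| (eqTest (Fin.ofNat k d) (Fin.ofNat k i)).bind fun e =>
    if e then pure (some false) else body.bind fun b =>
      if b then pure (some true) else (inc (Fin.ofNat k d)).seq (pure none)).bind fun b =>
  (reset (Fin.ofNat k d)).seq (pure b)

/-- In round `m` of a search, `body` leads from the input position `p m` and the output `o m` to
`p (m + 1)` and `o (m + 1)`. The search ends at `N`, which is either the bound or the first
value for which `body` gives `true`. -/
theorem runs_search {ρ : List ℕ} (hk : ρ.length < k) {i : ℕ} (hi : i < ρ.length)
    (hs : x.length.size + 1 < s) (hρ : ∀ v ∈ ρ, v ≤ x.length) {body : Subroutine k Bool}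
    (p : ℕ → ℕ) (o : ℕ → List Bool) {N : ℕ} (hp : ∀ m ≤ N, p m ≤ x.length + 1)
    (hbody : ∀ m < N, body.Runs x s (mem (ρ ++ [m]) (p m) (o m)) false
      (mem (ρ ++ [m]) (p (m + 1)) (o (m + 1)))) {r : Bool}
    (hend : (N = ρ.getD i 0 ∧ r = false) ∨ (N < ρ.getD i 0 ∧ r = true ∧
      body.Runs x s (mem (ρ ++ [N]) (p N) (o N)) true (mem (ρ ++ [N]) (p N) (o N)))) :
    (search ρ.length i body).Runs x s (mem ρ (p 0) (o 0)) r (mem ρ (p N) (o N)) := by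
  have hd : (Fin.ofNat k ρ.length).val = ρ.length := Nat.mod_eq_of_lt hk
  have hi' : (Fin.ofNat k i).val = i := Nat.mod_eq_of_lt (hi.trans hk)
  have hbound : ρ.getD i 0 ≤ x.length := by
    rw [List.getD_eq_getElem _ _ hi]
    exact hρ _ (List.getElem_mem _)
  have hN : N ≤ ρ.getD i 0 := by
    rcases hend with h | h
    · exact h.1.le
    · exact h.1.le
  have hsize : ∀ m ≤ N, m.size + 1 < s := fun m hm => by
    have := Nat.size_le_size (hm.trans (hN.trans hbound))
    omega
  have hcmp : ∀ m ≤ N, (eqTest (Fin.ofNat k ρ.length) (Fin.ofNat k i)).Runs x s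
      (mem (ρ ++ [m]) (p m) (o m)) (decide (m = ρ.getD i 0)) (mem (ρ ++ [m]) (p m) (o m)) := by
    intro m hm
    have h1 : (ρ ++ [m]).getD (Fin.ofNat k ρ.length).val 0 = m := by rw [hd]; simp
    have h2 : (ρ ++ [m]).getD (Fin.ofNat k i).val 0 = ρ.getD i 0 := by rw [hi']; grind
    have := runs_eqTest_mem (x := x) (s := s) (ρ := ρ ++ [m]) (t := Fin.ofNat k ρ.length)
      (u := Fin.ofNat k i) (o m) (hp m hm) (by rw [h1]; exact hsize m hm)
    rwa [h1, h2] at this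
  refine Runs.bind (d' := mem (ρ ++ [N]) (p N) (o N)) (b := r) ?_
    ((runs_reset hd (o N) (hp N le_rfl) (hsize N le_rfl)).seq
      (runs_pure r (within_mem (hp N le_rfl) (by omega))))
  rw [← mem_append_zero ρ]
  -- Induction on the number `j` of rounds that remain.
  suffices H : ∀ j m, m + j = N → (loop <| (eqTest (Fin.ofNat k ρ.length) (Fin.ofNat k i)).bind
      fun e => if e then pure (some false) else body.bind fun b =>
        if b then pure (some true) else (inc (Fin.ofNat k ρ.length)).seq (pure none)).Runs x s
      (mem (ρ ++ [m]) (p m) (o m)) r (mem (ρ ++ [N]) (p N) (o N)) from H N 0 (zero_add N)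
  intro j
  induction j with
  | zero =>
    rintro m rfl
    refine Runs.loop_some ((hcmp m le_rfl).bind ?_)
    rcases hend with ⟨h, rfl⟩ | ⟨h, rfl, hrun⟩
    · rw [if_pos (by simpa using h)]
      exact runs_pure _ (within_mem (hp m le_rfl) (by omega))
    · rw [if_neg (by simpa using h.ne)]
      exact hrun.bind (runs_pure _ (within_mem (hp m le_rfl) (by omega)))
  | succ j ih =>
    intro m hm
    refine Runs.loop_none ((hcmp m (by omega)).bind ?_) (ih (m + 1) (by omega))
    rw [if_neg (by simp only [decide_eq_true_eq]; omega)]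
    have := hsize (m + 1) (by omega)
    exact (hbody m (by omega)).bind ((runs_inc hd _ (hp _ (by omega)) (by omega)).seq
      (runs_pure _ (within_mem (hp _ (by omega)) (by omega))))

/-- Execute `F d` as often as the value of a term says; the tapes from `d` on are available for
counters, and `F` is told from which tape on they are free. -/
def repeatTerm : AddressTerm → ℕ → (ℕ → Subroutine k Unit) → Subroutine k Unit
  | .var i, d, F => (search d i ((F (d + 1)).seq (pure false))).bind fun _ => pure ()
  | .num n, d, F => n.rec (pure ()) fun _ M => (F d).seq M
  | .add a b, d, F => (repeatTerm a d F).seq (repeatTerm b d F)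
  | .mul a b, d, F => repeatTerm a d fun d' => repeatTerm b d' F

/-- The subroutine `F` moves the input head `c` cells to the right, in all environments that extend
`ρ` by at most `k - n - ρ.length` numbers. -/
def Advances (x : List Bool) (s : ℕ) (ρ : List ℕ) (n : ℕ) (F : ℕ → Subroutine k Unit) (c : ℕ) :
    Prop :=
  ∀ ρ', ρ <+: ρ' → (∀ v ∈ ρ', v ≤ x.length) → ρ'.length + n ≤ k → ∀ p ≤ x.length + 1, ∀ o,
    (F ρ'.length).Runs x s (mem ρ' p o) () (mem ρ' (min (p + c) (x.length + 1)) o)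

/-- Counting up to products by nested loops, the input head reaches the position that a term gives,
without the address being stored; beyond the end of the input it stays on the end marker. -/
theorem advances_repeatTerm (hs : x.length.size + 1 < s) {ρ : List ℕ} {e : AddressTerm}
    (he : e.fits ρ.length) {n c : ℕ} {F : ℕ → Subroutine k Unit} (hF : Advances x s ρ n F c) :
    Advances x s ρ (e.nesting + n) (fun d => repeatTerm e d F) (e.eval ρ * c) := by
  induction e generalizing n c F with
  | var i =>
    intro ρ' hpre hbd hlen p hp o
    simp only [AddressTerm.fits, decide_eq_true_eq] at he
    simp only [AddressTerm.nesting] at hlen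
    have hval : ρ'.getD i 0 = ρ.getD i 0 := AddressTerm.eval_of_prefix (e := .var i)
      (by simpa [AddressTerm.fits] using he) hpre
    have hi : i < ρ'.length := he.trans_le hpre.length_le
    refine Runs.bind (b := false) ?_ (runs_pure () (within_mem (min_le_right _ _) (by omega)))
    have := runs_search (x := x) (s := s) (k := k) (ρ := ρ') (i := i) (by omega) hi hs hbd
      (body := (F (ρ'.length + 1)).seq (pure false)) (fun m => min (p + m * c) (x.length + 1))
      (fun _ => o) (N := ρ'.getD i 0) (fun _ _ => min_le_right _ _) ?_
      (r := false) (.inl ⟨rfl, rfl⟩)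
    · rw [show (AddressTerm.var i).eval ρ = ρ'.getD i 0 from hval.symm]
      simpa [min_eq_left hp] using this
    · intro m hm
      have hmx : m ≤ x.length := by
        rw [List.getD_eq_getElem _ _ hi] at hm
        exact hm.le.trans (hbd _ (List.getElem_mem _))
      have := hF (ρ' ++ [m]) (hpre.trans (List.prefix_append _ _)) (by
        intro v hv
        rcases List.mem_append.1 hv with h | h
        · exact hbd v h
        · rw [List.mem_singleton.1 h]
          exact hmx) (by simp only [List.length_append, List.length_singleton]; omega)
        (min (p + m * c) (x.length + 1)) (min_le_right _ _) o
      rw [List.length_append, List.length_singleton] at this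
      refine Runs.congr (this.seq (runs_pure false (within_mem (min_le_right _ _) (by omega)))) ?_
      rw [Nat.succ_mul]
      congr 1
      omega
  | num m =>
    intro ρ' hpre hbd hlen p hp o
    simp only [AddressTerm.nesting, zero_add] at hlen
    simp only [AddressTerm.eval, repeatTerm]
    induction m generalizing p with
    | zero => simpa [min_eq_left hp] using runs_pure () (within_mem hp (by omega))
    | succ m ih =>
      refine Runs.seq (hF ρ' hpre hbd hlen p hp o) (Runs.congr (ih rfl _ (min_le_right _ _)) ?_)
      rw [Nat.succ_mul]
      congr 1
      omega
  | add a b iha ihb =>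
    simp only [AddressTerm.fits, Bool.and_eq_true] at he
    intro ρ' hpre hbd hlen p hp o
    simp only [AddressTerm.nesting] at hlen
    refine Runs.seq (iha he.1 hF ρ' hpre hbd (by omega) p hp o) ?_
    have := ihb he.2 hF ρ' hpre hbd (by omega) _ (min_le_right (p + a.eval ρ * c) (x.length + 1)) o
    refine Runs.congr this ?_
    simp only [AddressTerm.eval]
    rw [Nat.add_mul]
    congr 1
    omega
  | mul a b iha ihb =>
    simp only [AddressTerm.fits, Bool.and_eq_true] at he
    have := iha he.1 (ihb he.2 hF)
    simpa [AddressTerm.nesting, AddressTerm.eval, repeatTerm, Nat.mul_assoc, Nat.add_assoc]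
      using this

/-- Test whether the input has a bit `1` at the address `e`. -/
def bitTest (e : AddressTerm) (d : ℕ) : Subroutine k Bool :=
  (repeatTerm e d fun _ => moveRight).seq <| moveRight.seq <| scanBit.bind fun b =>
    rewindInput.seq (pure b)

theorem runs_bitTest (hs : x.length.size + 1 < s) {ρ : List ℕ} (hρ : ∀ v ∈ ρ, v ≤ x.length)
    {e : AddressTerm} (he : e.fits ρ.length) (hk : ρ.length + e.nesting ≤ k) (o : List Bool) :
    (bitTest e ρ.length : Subroutine k Bool).Runs x s (mem ρ 0 o) (x.getD (e.eval ρ) false)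
      (mem ρ 0 o) := by
  have hmove : Advances x s ρ 0 (fun _ => (moveRight : Subroutine k Unit)) 1 :=
    fun ρ' _ _ _ p hp o => runs_moveRight o hp (by omega)
  have hseek := advances_repeatTerm hs he hmove ρ (List.prefix_refl ρ) hρ (by omega) 0 (by omega) o
  refine hseek.seq ((runs_moveRight o (min_le_right _ _) (by omega)).seq ?_)
  have h1 : min (min (0 + e.eval ρ * 1) (x.length + 1) + 1) (x.length + 1) =
      min (e.eval ρ + 1) (x.length + 1) := by omega
  rw [h1]
  exact (runs_scanBit _ o (by omega)).bind ((runs_rewindInput o (min_le_right _ _) (by omega)).seq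
    (runs_pure _ (within_mem (by omega) (by omega))))

end Subroutine

namespace TableFormula

open Subroutine

variable {k : ℕ} [NeZero k] {x : List Bool} {s : ℕ}

/-- The subroutine that evaluates a formula in environments of length `d`. -/
def compile : TableFormula → ℕ → Subroutine k Bool
  | tt, _ => .pure true
  | bit e, d => bitTest e d
  | eq i j, _ => eqTest (Fin.ofNat k i) (Fin.ofNat k j)
  | and φ ψ, d => (φ.compile d).bind fun b => if b then ψ.compile d else .pure false
  | not φ, d => (φ.compile d).bind fun b => .pure !b
  | ex i φ, d => search d i (φ.compile (d + 1))

theorem runs_compile (hs : x.length.size + 1 < s) (φ : TableFormula) {ρ : List ℕ}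
    (hφ : φ.fits k ρ.length) (hρ : ∀ v ∈ ρ, v ≤ x.length) (o : List Bool) :
    (φ.compile ρ.length : Subroutine k Bool).Runs x s (mem ρ 0 o) (φ.eval x ρ) (mem ρ 0 o) := by
  have hmem : ∀ ρ : List ℕ, (mem ρ 0 o : Data k).Within x s := fun ρ =>
    within_mem (by omega) (by omega)
  induction φ generalizing ρ with
  | tt => exact runs_pure _ (hmem ρ)
  | bit e =>
    simp only [fits, Bool.and_eq_true, decide_eq_true_eq] at hφ
    exact runs_bitTest hs hρ hφ.1 hφ.2 o
  | eq i j =>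
    simp only [fits, Bool.and_eq_true, decide_eq_true_eq] at hφ
    obtain ⟨⟨hi, hj⟩, hk⟩ := hφ
    have hi' : (Fin.ofNat k i).val = i := Nat.mod_eq_of_lt (hi.trans_le hk)
    have hj' : (Fin.ofNat k j).val = j := Nat.mod_eq_of_lt (hj.trans_le hk)
    have hsize : (ρ.getD i 0).size + 1 < s := by
      rw [List.getD_eq_getElem _ _ hi]
      have := Nat.size_le_size (hρ _ (List.getElem_mem hi))
      omega
    have := runs_eqTest_mem (x := x) (s := s) (ρ := ρ) (t := Fin.ofNat k i) (u := Fin.ofNat k j)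
      (p := 0) o (by omega) (by rwa [hi'])
    rwa [hi', hj'] at this
  | and φ ψ ihφ ihψ =>
    simp only [fits, Bool.and_eq_true] at hφ
    refine (ihφ hφ.1 hρ).bind ?_
    simp only [eval]
    cases φ.eval x ρ with
    | true => exact ihψ hφ.2 hρ
    | false => exact runs_pure _ (hmem ρ)
  | not φ ih => exact (ih hφ hρ).bind (runs_pure _ (hmem ρ))
  | ex i φ ih =>
    simp only [fits, Bool.and_eq_true, decide_eq_true_eq] at hφ
    obtain ⟨⟨hi, hk⟩, hφ⟩ := hφ
    have hbound : ρ.getD i 0 ≤ x.length := by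
      rw [List.getD_eq_getElem _ _ hi]
      exact hρ _ (List.getElem_mem _)
    have hbody : ∀ m ≤ ρ.getD i 0, (φ.compile (ρ.length + 1) : Subroutine k Bool).Runs x s
        (mem (ρ ++ [m]) 0 o) (φ.eval x (ρ ++ [m])) (mem (ρ ++ [m]) 0 o) := by
      intro m hm
      have := ih (ρ := ρ ++ [m]) (by simpa using hφ) (by
        intro v hv
        rcases List.mem_append.1 hv with h | h
        · exact hρ v h
        · rw [List.mem_singleton.1 h]
          omega)
      simpa using this
    by_cases hex : ∃ m, m < ρ.getD i 0 ∧ φ.eval x (ρ ++ [m]) = true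
    · -- The search stops at the least witness.
      classical
      have hspec := Nat.find_spec hex
      have hmin : ∀ m < Nat.find hex, φ.eval x (ρ ++ [m]) = false := fun m hm => by
        have := Nat.find_min hex hm
        rw [not_and, Bool.not_eq_true] at this
        exact this (hm.trans hspec.1)
      have hval : (ex i φ).eval x ρ = true := by
        simp only [eval, List.any_eq_true, List.mem_range]
        exact hex
      rw [hval]
      refine runs_search hk hi hs hρ (fun _ => 0) (fun _ => o) (N := Nat.find hex)
        (fun _ _ => by omega) (fun m hm => ?_) (.inr ⟨hspec.1, rfl, ?_⟩)
      · have := hbody m (hm.le.trans hspec.1.le)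
        rwa [hmin m hm] at this
      · have := hbody _ hspec.1.le
        rwa [hspec.2] at this
    · have hval : (ex i φ).eval x ρ = false := by
        rw [Bool.eq_false_iff]
        simpa only [eval, ne_eq, List.any_eq_true, List.mem_range] using hex
      rw [hval]
      refine runs_search hk hi hs hρ (fun _ => 0) (fun _ => o) (N := ρ.getD i 0)
        (fun _ _ => by omega) (fun m hm => ?_) (.inl ⟨rfl, rfl⟩)
      have := hbody m hm.le
      rwa [Bool.eq_false_iff.2 fun h => hex ⟨m, hm, h⟩] at this

end TableFormula

namespace TableProgram

open Subroutine

variable {k : ℕ} [NeZero k] {x : List Bool} {s : ℕ}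

/-- The subroutine that executes a program in environments of length `d`. -/
def compile : TableProgram → ℕ → Subroutine k Unit
  | emit φ, d => (φ.compile d).bind emitBit
  | seq c₁ c₂, d => (c₁.compile d).seq (c₂.compile d)
  | loop i c, d => (search d i ((c.compile (d + 1)).seq (.pure false))).bind fun _ => .pure ()
  | letRun e c, d =>
      (Subroutine.loop <| (bitTest (e + .var d) (d + 1)).bind fun b =>
        if b then (inc (Fin.ofNat k d)).seq (.pure none) else .pure (some ())).seq <|
      (c.compile (d + 1)).seq <| reset (Fin.ofNat k d)

theorem runs_compile (hs : x.length.size + 1 < s) (c : TableProgram) {ρ : List ℕ}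
    (hc : c.fits k ρ.length) (hρ : ∀ v ∈ ρ, v ≤ x.length) (o : List Bool) :
    (c.compile ρ.length : Subroutine k Unit).Runs x s (mem ρ 0 o) ()
      (mem ρ 0 (o ++ c.eval x ρ)) := by
  have hmem : ∀ (ρ : List ℕ) o, (mem ρ 0 o : Data k).Within x s := fun ρ o =>
    within_mem (by omega) (by omega)
  have happend : ∀ {ρ : List ℕ} {m : ℕ}, (∀ v ∈ ρ, v ≤ x.length) → m ≤ x.length →
      ∀ v ∈ ρ ++ [m], v ≤ x.length := by
    intro ρ m hρ hm v hv
    rcases List.mem_append.1 hv with h | h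
    · exact hρ v h
    · rwa [List.mem_singleton.1 h]
  induction c generalizing ρ o with
  | emit φ =>
    exact (φ.runs_compile hs hc hρ o).bind (runs_emitBit _ o (by omega) (by omega))
  | seq c₁ c₂ ih₁ ih₂ =>
    simp only [fits, Bool.and_eq_true] at hc
    simp only [eval, ← List.append_assoc]
    exact (ih₁ hc.1 hρ o).seq (ih₂ hc.2 hρ _)
  | loop i c ih =>
    simp only [fits, Bool.and_eq_true, decide_eq_true_eq] at hc
    obtain ⟨⟨hi, hk⟩, hc⟩ := hc
    have hbound : ρ.getD i 0 ≤ x.length := by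
      rw [List.getD_eq_getElem _ _ hi]
      exact hρ _ (List.getElem_mem _)
    refine Runs.bind (b := false) ?_ (runs_pure () (hmem ρ _))
    have := runs_search (x := x) (s := s) hk hi hs hρ
      (body := (c.compile (ρ.length + 1)).seq (.pure false)) (fun _ => 0)
      (fun m => o ++ (List.range m).flatMap fun m => c.eval x (ρ ++ [m])) (N := ρ.getD i 0)
      (fun _ _ => by omega) (fun m hm => ?_) (r := false) (.inl ⟨rfl, rfl⟩)
    · simpa [eval] using this
    · have := ih (ρ := ρ ++ [m]) (by simpa using hc) (happend hρ (by omega))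
        (o ++ (List.range m).flatMap fun m => c.eval x (ρ ++ [m]))
      rw [List.length_append, List.length_singleton] at this
      refine Runs.congr (this.seq (runs_pure false (hmem _ _))) ?_
      rw [List.range_succ, List.flatMap_append, List.append_assoc]
      simp
  | letRun e c ih =>
    simp only [fits, Bool.and_eq_true, decide_eq_true_eq] at hc
    obtain ⟨⟨⟨he, hk⟩, hn⟩, hc⟩ := hc
    have hd : (Fin.ofNat k ρ.length).val = ρ.length := Nat.mod_eq_of_lt hk
    have htest : ∀ l a : List Bool, x.drop (e.eval ρ) = a ++ l → a.length ≤ x.length →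
        (bitTest (e + .var ρ.length) (ρ.length + 1) : Subroutine k Bool).Runs x s
          (mem (ρ ++ [a.length]) 0 o) (l.headD false) (mem (ρ ++ [a.length]) 0 o) := by
      intro l a ha hlen
      have he' : e.fits (ρ ++ [a.length]).length := AddressTerm.fits_mono he (by simp)
      have := runs_bitTest (k := k) hs (ρ := ρ ++ [a.length]) (happend hρ hlen)
        (e := e + .var ρ.length)
        (by change (e.fits _ && _) = true; rw [he']; simp [AddressTerm.fits])
        (by
          change _ + max e.nesting 1 ≤ k
          rw [List.length_append, List.length_singleton]
          omega) o
      have hbit : x.getD ((e + .var ρ.length : AddressTerm).eval (ρ ++ [a.length])) false =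
          l.headD false := by
        change x.getD (e.eval (ρ ++ [a.length]) + (ρ ++ [a.length]).getD ρ.length 0) false = _
        rw [AddressTerm.eval_of_prefix he (List.prefix_append _ _)]
        have h1 : x.getD (e.eval ρ + a.length) false = (a ++ l).getD a.length false := by
          rw [← ha]
          simp
        have h2 : (ρ ++ [a.length]).getD ρ.length 0 = a.length := by simp
        rw [h2, h1]
        cases l <;> simp
      rwa [hbit, List.length_append, List.length_singleton] at this
    -- The ones in `a` have been counted; induction on the rest `l` of the input.
    have hrun : ∀ l a : List Bool, x.drop (e.eval ρ) = a ++ l →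
        (Subroutine.loop <| (bitTest (e + .var ρ.length) (ρ.length + 1)).bind fun b =>
          if b then (inc (Fin.ofNat k ρ.length)).seq (.pure none) else .pure (some ())).Runs x s
        (mem (ρ ++ [a.length]) 0 o) ()
        (mem (ρ ++ [a.length + (l.takeWhile id).length]) 0 o) := by
      intro l
      induction l with
      | nil =>
        intro a ha
        have hlen := congrArg List.length ha
        simp only [List.length_drop, List.length_append] at hlen
        exact Runs.loop_some ((htest [] a ha (by omega)).bind (runs_pure _ (hmem _ _)))
      | cons b l ihl =>
        intro a ha
        have hlen := congrArg List.length ha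
        simp only [List.length_drop, List.length_append, List.length_cons] at hlen
        cases b with
        | false => exact Runs.loop_some ((htest _ a ha (by omega)).bind (runs_pure _ (hmem _ _)))
        | true =>
          have hsize := Nat.size_le_size (show a.length + 1 ≤ x.length by omega)
          have hrec := ihl (a ++ [true]) (by simpa using ha)
          rw [List.length_append, List.length_singleton] at hrec
          refine Runs.loop_none ((htest _ a ha (by omega)).bind
            ((runs_inc hd o (by omega) (by omega)).seq (runs_pure _ (hmem _ _))))
            (Runs.congr hrec ?_)
          simp only [List.takeWhile_cons, id_eq, if_true, List.length_cons]
          congr 3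
          omega
    have hval : ((x.drop (e.eval ρ)).takeWhile id).length ≤ x.length :=
      ((List.takeWhile_prefix _).length_le).trans (by simp)
    have hstart := hrun (x.drop (e.eval ρ)) [] rfl
    rw [List.length_nil, mem_append_zero, zero_add] at hstart
    have hbody := ih (ρ := ρ ++ [((x.drop (e.eval ρ)).takeWhile id).length]) (by simpa using hc)
      (happend hρ hval) o
    rw [List.length_append, List.length_singleton] at hbody
    have hsize := Nat.size_le_size hval
    exact hstart.seq (hbody.seq (runs_reset hd _ (by omega) (by omega)))

end TableProgram

/-- A function whose values are written by a table program is computable in logarithmic space. -/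
theorem TableProgram.logspaceComputable {α β : Type*} {encα : α → List Bool} {encβ : β → List Bool}
    {f : α → β} (c : TableProgram) (k : ℕ) [NeZero k] (hc : c.fits k 0)
    (h : ∀ a, c.eval (encα a) [] = encβ (f a)) : LogspaceComputable encα encβ f := by
  refine ⟨(Subroutine.markTapes.seq (c.compile 0) : Subroutine k Unit).toTransducer, 4, fun a => ?_⟩
  -- Counters have at most as many bits as the length of the input; two cells more are visited.
  have hs : (encα a).length.size + 1 < 4 * (Nat.log 2 (encα a).length + 1) := by
    have : (encα a).length.size ≤ Nat.log 2 (encα a).length + 1 :=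
      Nat.size_le.2 (Nat.lt_pow_succ_log_self one_lt_two _)
    omega
  refine Subroutine.Runs.computesInSpace (d := Subroutine.mem [] 0 (encβ (f a)))
    ((Subroutine.runs_markTapes (by omega)).seq ?_) rfl
  have := c.runs_compile (k := k) hs (ρ := []) hc (by simp) []
  rwa [h, List.nil_append] at this

/-! ### Reading and writing tables -/

theorem length_unary (n : ℕ) : (unary n).length = n + 1 := by
  simp [unary]

theorem length_table {n : ℕ} {f : Fin n → List Bool} {w : ℕ} (h : ∀ i, (f i).length = w) :
    (table n f).length = n * w := by
  simp [table, List.length_flatMap, h]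

theorem length_table₁ {n : ℕ} {p : Fin n → Prop} :
    (table n fun i => truthBit (p i)).length = n :=
  (length_table (w := 1) fun _ => rfl).trans (mul_one n)

theorem length_table₂ {m n : ℕ} {p : Fin m → Fin n → Prop} :
    (table m fun i => table n fun j => truthBit (p i j)).length = m * n :=
  length_table fun _ => length_table₁

theorem length_table₃ {l m n : ℕ} {p : Fin l → Fin m → Fin n → Prop} :
    (table l fun h => table m fun i => table n fun j => truthBit (p h i j)).length = l * m * n :=
  (length_table fun _ => length_table₂).trans (mul_assoc l m n).symm

theorem length_table₄ {l m n o : ℕ} {p : Fin l → Fin m → Fin n → Fin o → Prop} :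
    (table l fun h => table m fun i => table n fun j => table o fun k =>
      truthBit (p h i j k)).length = l * m * n * o :=
  (length_table fun _ => length_table₃).trans (by simp only [mul_assoc])

theorem table_congr {n : ℕ} {f g : Fin n → List Bool} (h : ∀ i, f i = g i) :
    table n f = table n g := by
  rw [funext h]

theorem table_eq_flatMap_range (n : ℕ) (g : ℕ → List Bool) :
    table n (fun i => g i) = (List.range n).flatMap g := by
  rw [table, ← List.map_coe_finRange_eq_range, List.flatMap_map]

theorem table_succ (n : ℕ) (f : Fin (n + 1) → List Bool) :
    table (n + 1) f = f 0 ++ table n fun i => f i.succ := by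
  simp [table, List.finRange_succ, List.flatMap_map]

theorem flatMap_range_mul (m n : ℕ) (g : ℕ → List Bool) :
    (List.range (m * n)).flatMap g =
      (List.range m).flatMap fun i => (List.range n).flatMap fun j => g (j + n * i) := by
  induction m with
  | zero => simp
  | succ m ih =>
    rw [Nat.succ_mul, List.range_add, List.flatMap_append, ih, List.range_succ,
      List.flatMap_append, List.flatMap_map]
    simp [add_comm, mul_comm]

theorem table_mul (m n : ℕ) (f : Fin (m * n) → List Bool) :
    table (m * n) f = table m fun i => table n fun j => f (finProdFinEquiv (i, j)) := by
  -- Extended by the empty word, `f` is defined on all numbers, and tables are loops over ranges.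
  let g : ℕ → List Bool := fun i => if h : i < m * n then f ⟨i, h⟩ else []
  have hg : ∀ i : Fin (m * n), g i = f i := fun i => dif_pos i.2
  rw [← funext hg, table_eq_flatMap_range, flatMap_range_mul, ← table_eq_flatMap_range]
  refine table_congr fun i => ?_
  rw [← table_eq_flatMap_range]
  refine table_congr fun j => ?_
  simp [finProdFinEquiv]

/-- The word `l` occurs in `x` from position `a` on. -/
def OccursAt (x : List Bool) (a : ℕ) (l : List Bool) : Prop :=
  ∃ u v, x = u ++ l ++ v ∧ u.length = a

namespace OccursAt

variable {x l l' : List Bool} {a : ℕ}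

theorem refl (x : List Bool) : OccursAt x 0 x := ⟨[], [], by simp, rfl⟩

theorem left (h : OccursAt x a (l ++ l')) : OccursAt x a l := by
  obtain ⟨u, v, rfl, rfl⟩ := h
  exact ⟨u, l' ++ v, by simp, rfl⟩

theorem right (h : OccursAt x a (l ++ l')) : OccursAt x (a + l.length) l' := by
  obtain ⟨u, v, rfl, rfl⟩ := h
  exact ⟨u ++ l, v, by simp, by simp⟩

theorem table {n : ℕ} {f : Fin n → List Bool} (h : OccursAt x a (table n f)) {w : ℕ}
    (hw : ∀ i, (f i).length = w) (i : Fin n) : OccursAt x (a + i * w) (f i) := by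
  induction n generalizing a with
  | zero => exact i.elim0
  | succ n ih =>
    rw [table_succ] at h
    refine i.cases ?_ fun i => ?_
    · simp [h.left]
    · have := ih h.right (fun i => hw i.succ) i
      rw [hw] at this
      convert this using 1
      simp [Nat.succ_mul]
      omega

theorem getD_table {n : ℕ} {p : Fin n → Prop}
    (h : OccursAt x a (_root_.table n fun i => truthBit (p i))) (i : Fin n) :
    x.getD (a + i) false = true ↔ p i := by
  have h := h.table (w := 1) (fun _ => rfl) i
  rw [mul_one] at h
  obtain ⟨u, v, hx, ha⟩ := h
  rw [hx, ← ha]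
  simp [truthBit]

theorem length_takeWhile {n : ℕ} (h : OccursAt x a (unary n)) :
    ((x.drop a).takeWhile id).length = n := by
  obtain ⟨u, v, rfl, rfl⟩ := h
  rw [List.append_assoc, List.drop_left, unary, List.append_assoc]
  simp

theorem congr {b : ℕ} (h : OccursAt x a l) (hab : a = b) : OccursAt x b l := hab ▸ h

end OccursAt

namespace TableProgram

theorem eval_emit {x : List Bool} {φ : TableFormula} {ρ : List ℕ} {p : Prop}
    (h : φ.eval x ρ = true ↔ p) : (emit φ).eval x ρ = truthBit p := by
  classical
  simp only [eval, truthBit, List.cons.injEq, and_true]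
  rw [Bool.eq_iff_iff, h, decide_eq_true_iff]

theorem eval_seq {x : List Bool} {c₁ c₂ : TableProgram} {ρ : List ℕ} :
    (c₁.seq c₂).eval x ρ = c₁.eval x ρ ++ c₂.eval x ρ :=
  rfl

theorem eval_loop {x : List Bool} {c : TableProgram} {ρ : List ℕ} {i n : ℕ}
    {f : Fin n → List Bool} (hi : ρ.getD i 0 = n) (h : ∀ m : Fin n, c.eval x (ρ ++ [m.val]) = f m) :
    (loop i c).eval x ρ = table n f := by
  rw [eval, hi, ← table_eq_flatMap_range]
  exact table_congr h

/-- Write a number in unary, given a program that writes that many ones. -/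
def terminate (c : TableProgram) : TableProgram := c.seq (emit (.not .tt))

theorem eval_terminate {x : List Bool} {c : TableProgram} {ρ : List ℕ} {n : ℕ}
    (h : c.eval x ρ = table n fun _ => truthBit True) : (terminate c).eval x ρ = unary n := by
  have hones : table n (fun _ => truthBit True) = List.replicate n true := by
    rw [List.eq_replicate_iff, length_table fun _ => rfl]
    simp [table, truthBit]
  rw [terminate, eval, h, hones, unary]
  rfl

theorem eval_ones {x : List Bool} {ρ : List ℕ} {i n : ℕ} (hi : ρ.getD i 0 = n) :
    (loop i (emit .tt)).eval x ρ = table n fun _ => truthBit True :=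
  eval_loop hi fun _ => eval_emit (by simp [TableFormula.eval])

/-- Execute a program in the environment of the five numbers in unary with which the input
starts. -/
def withHeader (c : TableProgram) : TableProgram :=
  letRun 0 <| letRun (.var 0 + 1) <| letRun (.var 0 + .var 1 + 2) <|
  letRun (.var 0 + .var 1 + .var 2 + 3) <| letRun (.var 0 + .var 1 + .var 2 + .var 3 + 4) c

theorem eval_withHeader {c : TableProgram} {n₀ n₁ n₂ n₃ n₄ : ℕ} {x : List Bool}
    (h : OccursAt x 0 (unary n₀ ++ unary n₁ ++ unary n₂ ++ unary n₃ ++ unary n₄)) :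
    (withHeader c).eval x [] = c.eval x [n₀, n₁, n₂, n₃, n₄] := by
  have h₄ := h.right.length_takeWhile
  have h₃ := h.left.right.length_takeWhile
  have h₂ := h.left.left.right.length_takeWhile
  have h₁ := h.left.left.left.right.length_takeWhile
  have h₀ := h.left.left.left.left.length_takeWhile
  simp only [List.length_append, length_unary] at h₀ h₁ h₂ h₃ h₄
  have hletRun : ∀ (e : AddressTerm) (c : TableProgram) (ρ : List ℕ) {a n : ℕ},
      ((x.drop a).takeWhile id).length = n → e.eval ρ = a →
      (letRun e c).eval x ρ = c.eval x (ρ ++ [n]) := by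
    rintro e c ρ a n hn rfl
    rw [eval, hn]
  rw [withHeader, hletRun _ _ _ h₀ rfl, hletRun _ _ _ h₁, hletRun _ _ _ h₂, hletRun _ _ _ h₃,
    hletRun _ _ _ h₄]
  · rfl
  · change n₀ + n₁ + n₂ + n₃ + 4 = _
    omega
  · change n₀ + n₁ + n₂ + 3 = _
    omega
  · change n₀ + n₁ + 2 = _
    omega
  · change n₀ + 1 = _
    omega

end TableProgram

theorem TableFormula.eval_and {x : List Bool} {φ ψ : TableFormula} {ρ : List ℕ} :
    (φ.and ψ).eval x ρ = true ↔ φ.eval x ρ = true ∧ ψ.eval x ρ = true := by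
  simp [TableFormula.eval]

theorem TableFormula.eval_eq {x : List Bool} {i j : ℕ} {ρ : List ℕ} :
    (TableFormula.eq i j).eval x ρ = true ↔ ρ.getD i 0 = ρ.getD j 0 := by
  simp [TableFormula.eval]

theorem TableFormula.eval_ex {x : List Bool} {φ : TableFormula} {ρ : List ℕ} {i n : ℕ}
    (hi : ρ.getD i 0 = n) :
    (TableFormula.ex i φ).eval x ρ = true ↔ ∃ m : Fin n, φ.eval x (ρ ++ [m.val]) = true := by
  rw [TableFormula.eval, hi, List.any_eq_true]
  constructor
  · rintro ⟨m, hm, h⟩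
    exact ⟨⟨m, List.mem_range.1 hm⟩, h⟩
  · rintro ⟨m, h⟩
    exact ⟨m, List.mem_range.2 m.2, h⟩

/-! ### Computing the translation of visibly recursive automata -/

namespace NumVRA

variable {s : AlphabetSize}

theorem stateAt_mem_initials {A : NumVRA s} {q : Fin A.states} {J : Option (Fin A.procs)} :
    A.stateAt q ∈ A.toVRA.initials J ↔
      A.owner q = J ∧ A.stateAt q ∈ A.toVRA.initials (A.owner q) := by
  simp [stateAt, VRA.mk_mem_initials]

theorem stateAt_mem_finals {A : NumVRA s} {q : Fin A.states} {J : Option (Fin A.procs)} :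
    A.stateAt q ∈ A.toVRA.finals J ↔
      A.owner q = J ∧ A.stateAt q ∈ A.toVRA.finals (A.owner q) := by
  simp [stateAt, VRA.mk_mem_finals]

/-- The numbered visibly pushdown automaton with the same configurations and steps. -/
def toNumVPA (A : NumVRA s) : NumVPA s where
  stackSyms := A.states
  states := A.states
  toVPA := A.toVRA.toVPA (Equiv.sigmaFiberEquiv A.owner).symm

/-- The numbers at the beginning of the encoding. -/
def header (A : NumVRA s) : List ℕ := [s.int, s.call, s.ret, A.procs, A.states]

namespace Bits

/-! In the following formulas, the variables `0`, …, `4` stand for the numbers of internal, call and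
return symbols, procedural symbols and states. -/

/-- The address behind the header. -/
def addr₀ : AddressTerm := .var 0 + .var 1 + .var 2 + .var 3 + .var 4 + 5

/-- The address behind the table of call symbols of the linking function. -/
def addr₁ : AddressTerm := addr₀ + .var 3 * .var 1

/-- The address behind the table of return symbols of the linking function. -/
def addr₂ : AddressTerm := addr₁ + .var 3 * .var 2

/-- The address behind the table of the states of the starting automaton. -/
def addr₃ : AddressTerm := addr₂ + .var 4

/-- The address behind the table of the states of the other automata. -/
def addr₄ : AddressTerm := addr₃ + .var 4 * .var 3

/-- The address behind the table of initial states. -/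
def addr₅ : AddressTerm := addr₄ + .var 4

/-- The address behind the table of final states. -/
def addr₆ : AddressTerm := addr₅ + .var 4

/-- The address behind the table of internal transitions. -/
def addr₇ : AddressTerm := addr₆ + .var 4 * .var 0 * .var 4

/-- The procedural symbol `J` has the call symbol `c`. -/
def linkCall (J c : ℕ) : TableFormula := .bit (addr₀ + .var J * .var 1 + .var c)

/-- The procedural symbol `J` has the return symbol `r`. -/
def linkRet (J r : ℕ) : TableFormula := .bit (addr₁ + .var J * .var 2 + .var r)

/-- The state `q` belongs to the starting automaton. -/
def ownerNone (q : ℕ) : TableFormula := .bit (addr₂ + .var q)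

/-- The state `q` belongs to the automaton `J`. -/
def ownerSome (q J : ℕ) : TableFormula := .bit (addr₃ + .var q * .var 3 + .var J)

/-- The state `q` is initial in its automaton. -/
def initial (q : ℕ) : TableFormula := .bit (addr₄ + .var q)

/-- The state `q` is final in its automaton. -/
def final (q : ℕ) : TableFormula := .bit (addr₅ + .var q)

/-- There is an `a`-transition from `q` to `p`, for an internal symbol `a`. -/
def intTrans (q a p : ℕ) : TableFormula :=
  .bit (addr₆ + .var q * (.var 0 * .var 4) + .var a * .var 4 + .var p)

/-- There is a `J`-transition from `q` to `p`, for a procedural symbol `J`. -/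
def procTrans (q J p : ℕ) : TableFormula :=
  .bit (addr₇ + .var q * (.var 3 * .var 4) + .var J * .var 4 + .var p)

variable (A : NumVRA s) {ρ : List ℕ}

/-- The tables follow one another in the encoding at the addresses given by the terms. -/
theorem occursAt_tables (hρ : A.header <+: ρ) :
    OccursAt A.encode 0 (unary s.int ++ unary s.call ++ unary s.ret ++ unary A.procs ++
      unary A.states) ∧
    OccursAt A.encode (addr₀.eval ρ)
      (table A.procs fun J => table s.call fun c => truthBit ((A.toVRA.link J).1 = c)) ∧
    OccursAt A.encode (addr₁.eval ρ)
      (table A.procs fun J => table s.ret fun r => truthBit ((A.toVRA.link J).2 = r)) ∧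
    OccursAt A.encode (addr₂.eval ρ) (table A.states fun q => truthBit (A.owner q = none)) ∧
    OccursAt A.encode (addr₃.eval ρ)
      (table A.states fun q => table A.procs fun J => truthBit (A.owner q = some J)) ∧
    OccursAt A.encode (addr₄.eval ρ)
      (table A.states fun q => truthBit (A.stateAt q ∈ A.toVRA.initials (A.owner q))) ∧
    OccursAt A.encode (addr₅.eval ρ)
      (table A.states fun q => truthBit (A.stateAt q ∈ A.toVRA.finals (A.owner q))) ∧
    OccursAt A.encode (addr₆.eval ρ)
      (table A.states fun q => table s.int fun a => table A.states fun p =>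
        truthBit ((A.stateAt q, Sum.inl a, A.stateAt p) ∈ A.toVRA.trans)) ∧
    OccursAt A.encode (addr₇.eval ρ)
      (table A.states fun q => table A.procs fun J => table A.states fun p =>
        truthBit ((A.stateAt q, Sum.inr J, A.stateAt p) ∈ A.toVRA.trans)) := by
  have h := OccursAt.refl A.encode
  obtain ⟨σ, rfl⟩ := hρ
  have h₇ := h.right
  have h₆ := h.left.right
  have h₅ := h.left.left.right
  have h₄ := h.left.left.left.right
  have h₃ := h.left.left.left.left.right
  have h₂ := h.left.left.left.left.left.right
  have h₁ := h.left.left.left.left.left.left.right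
  have h₀ := h.left.left.left.left.left.left.left.right
  have e₀ : addr₀.eval (A.header ++ σ) = s.int + s.call + s.ret + A.procs + A.states + 5 := rfl
  have e₁ : addr₁.eval (A.header ++ σ) = addr₀.eval (A.header ++ σ) + A.procs * s.call := rfl
  have e₂ : addr₂.eval (A.header ++ σ) = addr₁.eval (A.header ++ σ) + A.procs * s.ret := rfl
  have e₃ : addr₃.eval (A.header ++ σ) = addr₂.eval (A.header ++ σ) + A.states := rfl
  have e₄ : addr₄.eval (A.header ++ σ) = addr₃.eval (A.header ++ σ) + A.states * A.procs := rfl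
  have e₅ : addr₅.eval (A.header ++ σ) = addr₄.eval (A.header ++ σ) + A.states := rfl
  have e₆ : addr₆.eval (A.header ++ σ) = addr₅.eval (A.header ++ σ) + A.states := rfl
  have e₇ : addr₇.eval (A.header ++ σ) =
      addr₆.eval (A.header ++ σ) + A.states * s.int * A.states := rfl
  simp only [List.length_append, length_unary, length_table₁, length_table₂, length_table₃]
    at h₀ h₁ h₂ h₃ h₄ h₅ h₆ h₇
  exact ⟨h.left.left.left.left.left.left.left.left, h₀.congr (by omega), h₁.congr (by omega),
    h₂.congr (by omega), h₃.congr (by omega), h₄.congr (by omega), h₅.congr (by omega),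
    h₆.congr (by omega), h₇.congr (by omega)⟩

theorem getD_header (hρ : A.header <+: ρ) : ρ.getD 0 0 = s.int ∧ ρ.getD 1 0 = s.call ∧
    ρ.getD 2 0 = s.ret ∧ ρ.getD 3 0 = A.procs ∧ ρ.getD 4 0 = A.states := by
  obtain ⟨σ, rfl⟩ := hρ
  exact ⟨rfl, rfl, rfl, rfl, rfl⟩

variable {A} {i j k : ℕ}

theorem eval_linkCall (hρ : A.header <+: ρ) {J : Fin A.procs} {c : Fin s.call}
    (hJ : ρ.getD i 0 = J) (hc : ρ.getD j 0 = c) :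
    (linkCall i j).eval A.encode ρ = true ↔ (A.toVRA.link J).1 = c := by
  have h := (((occursAt_tables A hρ).2.1.table (fun _ => length_table₁) J).getD_table c)
  rw [← h, ← hJ, ← hc, ← (getD_header A hρ).2.1]
  rfl

theorem eval_linkRet (hρ : A.header <+: ρ) {J : Fin A.procs} {r : Fin s.ret}
    (hJ : ρ.getD i 0 = J) (hr : ρ.getD j 0 = r) :
    (linkRet i j).eval A.encode ρ = true ↔ (A.toVRA.link J).2 = r := by
  have h := (((occursAt_tables A hρ).2.2.1.table (fun _ => length_table₁) J).getD_table r)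
  rw [← h, ← hJ, ← hr, ← (getD_header A hρ).2.2.1]
  rfl

theorem eval_ownerNone (hρ : A.header <+: ρ) {q : Fin A.states} (hq : ρ.getD i 0 = q) :
    (ownerNone i).eval A.encode ρ = true ↔ A.owner q = none := by
  have h := ((occursAt_tables A hρ).2.2.2.1.getD_table q)
  rw [← h, ← hq]
  rfl

theorem eval_ownerSome (hρ : A.header <+: ρ) {q : Fin A.states} {J : Fin A.procs}
    (hq : ρ.getD i 0 = q) (hJ : ρ.getD j 0 = J) :
    (ownerSome i j).eval A.encode ρ = true ↔ A.owner q = some J := by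
  have h := (((occursAt_tables A hρ).2.2.2.2.1.table (fun _ => length_table₁) q).getD_table J)
  rw [← h, ← hq, ← hJ, ← (getD_header A hρ).2.2.2.1]
  rfl

theorem eval_initial (hρ : A.header <+: ρ) {q : Fin A.states} (hq : ρ.getD i 0 = q) :
    (initial i).eval A.encode ρ = true ↔ A.stateAt q ∈ A.toVRA.initials (A.owner q) := by
  have h := ((occursAt_tables A hρ).2.2.2.2.2.1.getD_table q)
  rw [← h, ← hq]
  rfl

theorem eval_final (hρ : A.header <+: ρ) {q : Fin A.states} (hq : ρ.getD i 0 = q) :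
    (final i).eval A.encode ρ = true ↔ A.stateAt q ∈ A.toVRA.finals (A.owner q) := by
  have h := ((occursAt_tables A hρ).2.2.2.2.2.2.1.getD_table q)
  rw [← h, ← hq]
  rfl

theorem eval_intTrans (hρ : A.header <+: ρ) {q p : Fin A.states} {a : Fin s.int}
    (hq : ρ.getD i 0 = q) (ha : ρ.getD j 0 = a) (hp : ρ.getD k 0 = p) :
    (intTrans i j k).eval A.encode ρ = true ↔
      (A.stateAt q, Sum.inl a, A.stateAt p) ∈ A.toVRA.trans := by
  have h := ((((occursAt_tables A hρ).2.2.2.2.2.2.2.1.table (fun _ => length_table₂) q).table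
    (fun _ => length_table₁) a).getD_table p)
  obtain ⟨h₀, -, -, -, h₄⟩ := getD_header A hρ
  rw [← h, ← hq, ← ha, ← hp, ← h₀, ← h₄]
  rfl

theorem eval_procTrans (hρ : A.header <+: ρ) {q p : Fin A.states} {J : Fin A.procs}
    (hq : ρ.getD i 0 = q) (hJ : ρ.getD j 0 = J) (hp : ρ.getD k 0 = p) :
    (procTrans i j k).eval A.encode ρ = true ↔
      (A.stateAt q, Sum.inr J, A.stateAt p) ∈ A.toVRA.trans := by
  have h := ((((occursAt_tables A hρ).2.2.2.2.2.2.2.2.table (fun _ => length_table₂) q).table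
    (fun _ => length_table₁) J).getD_table p)
  obtain ⟨-, -, -, h₃, h₄⟩ := getD_header A hρ
  rw [← h, ← hq, ← hJ, ← hp, ← h₃, ← h₄]
  rfl

end Bits

open Bits TableProgram

/-- The program that writes the encoding of the visibly pushdown automaton. In every table the
variables from `5` on stand for the indices of the entry. -/
def program : TableProgram :=
  withHeader <|
  (terminate <| loop 0 <| emit .tt).seq <|
  (terminate <| loop 1 <| emit .tt).seq <|
  (terminate <| loop 2 <| emit .tt).seq <|
  (terminate <| loop 4 <| emit .tt).seq <|
  (terminate <| loop 4 <| emit .tt).seq <|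
  (loop 4 <| emit <| (ownerNone 5).and (initial 5)).seq <|
  (loop 4 <| emit <| (ownerNone 5).and (final 5)).seq <|
  (loop 4 <| loop 0 <| loop 4 <| emit <| intTrans 5 6 7).seq <|
  (loop 4 <| loop 1 <| loop 4 <| loop 4 <| emit <| TableFormula.ex 3 <|
    (linkCall 9 6).and <| ((ownerSome 7 9).and (initial 7)).and <| procTrans 5 9 8).seq <|
  loop 4 <| loop 2 <| loop 4 <| loop 4 <| emit <|
    (TableFormula.ex 3 <| (linkRet 9 6).and <| (ownerSome 5 9).and <| final 5).and <| .eq 7 8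

theorem eval_program (A : NumVRA s) : program.eval A.encode [] = A.toNumVPA.encode := by
  rw [program, eval_withHeader (occursAt_tables A (List.prefix_refl _)).1]
  have hpre : ∀ σ, A.header <+: A.header ++ σ := fun σ => List.prefix_append _ σ
  simp only [TableProgram.eval_seq, NumVPA.encode, List.append_assoc]
  refine congrArg₂ _ (eval_terminate (eval_ones rfl)) <|
    congrArg₂ _ (eval_terminate (eval_ones rfl)) <|
    congrArg₂ _ (eval_terminate (eval_ones rfl)) <|
    congrArg₂ _ (eval_terminate (eval_ones rfl)) <|
    congrArg₂ _ (eval_terminate (eval_ones rfl)) <|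
    congrArg₂ _ ?_ <| congrArg₂ _ ?_ <| congrArg₂ _ ?_ <| congrArg₂ _ ?_ ?_
  · refine eval_loop rfl fun q => eval_emit ?_
    refine (TableFormula.eval_and.trans (and_congr (eval_ownerNone (hpre [q.val]) (q := q) rfl)
      (eval_initial (hpre [q.val]) (q := q) rfl))).trans ?_
    exact stateAt_mem_initials.symm
  · refine eval_loop rfl fun q => eval_emit ?_
    refine (TableFormula.eval_and.trans (and_congr (eval_ownerNone (hpre [q.val]) (q := q) rfl)
      (eval_final (hpre [q.val]) (q := q) rfl))).trans ?_
    exact stateAt_mem_finals.symm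
  · refine eval_loop rfl fun q => eval_loop rfl fun a => eval_loop rfl fun p => eval_emit ?_
    exact eval_intTrans (hpre [q.val, a.val, p.val]) rfl rfl rfl
  · refine eval_loop rfl fun q => eval_loop rfl fun c => eval_loop rfl fun p =>
      eval_loop rfl fun g => eval_emit ?_
    rw [TableFormula.eval_ex (n := A.procs) rfl]
    refine exists_congr fun J => ?_
    have hρ := hpre [q.val, c.val, p.val, g.val, J.val]
    rw [TableFormula.eval_and, TableFormula.eval_and, TableFormula.eval_and]
    refine and_congr (eval_linkCall hρ rfl rfl) (and_congr ?_ (eval_procTrans hρ rfl rfl rfl))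
    refine (and_congr (eval_ownerSome hρ (q := p) rfl rfl) (eval_initial hρ (q := p) rfl)).trans ?_
    exact stateAt_mem_initials.symm
  · refine eval_loop rfl fun q => eval_loop rfl fun r => eval_loop rfl fun g =>
      eval_loop rfl fun p => eval_emit ?_
    rw [TableFormula.eval_and, TableFormula.eval_ex (n := A.procs) rfl, TableFormula.eval_eq]
    refine and_congr (exists_congr fun J => ?_) Fin.ext_iff.symm
    have hρ := hpre [q.val, r.val, g.val, p.val, J.val]
    rw [TableFormula.eval_and, TableFormula.eval_and]
    refine and_congr (eval_linkRet hρ rfl rfl) ?_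
    refine (and_congr (eval_ownerSome hρ (q := q) rfl rfl) (eval_final hρ (q := q) rfl)).trans ?_
    exact stateAt_mem_finals.symm

theorem logspaceComputable_toNumVPA :
    LogspaceComputable (fun A : Σ s, NumVRA s => A.2.encode) (fun B : Σ s, NumVPA s => B.2.encode)
      (fun A => ⟨A.1, A.2.toNumVPA⟩) :=
  -- At most ten variables are in use at a time; three counters serve to compute addresses.
  program.logspaceComputable 13 (by decide) fun A => eval_program A.2

end NumVRA

/-! ### Computing the translation of visibly pushdown automata -/

namespace NumVPA

variable {s : AlphabetSize}

/-- The number of procedural symbols of the visibly recursive automaton. -/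
abbrev procs (B : NumVPA s) : ℕ := B.states * B.states * (s.call * s.ret)

/-- The numbering of the procedural symbols, in lexicographic order. -/
def procEquiv (B : NumVPA s) :
    Fin B.procs ≃ (Fin B.states × Fin B.states) × Fin s.call × Fin s.ret :=
  finProdFinEquiv.symm.trans (Equiv.prodCongr finProdFinEquiv.symm finProdFinEquiv.symm)

/-- The numbering of the states of the visibly recursive automaton: those of the starting
automaton, and those of the other automata in the order of the procedural symbols. -/
def stateEquiv (B : NumVPA s) :
    Fin ((B.procs + 1) * B.states) ≃ Option (Fin B.procs) × Fin B.states :=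
  finProdFinEquiv.symm.trans (Equiv.prodCongr (finSuccEquiv _) (Equiv.refl _))

/-- The automaton `J` is a copy of the given automaton. -/
def copyEquiv (B : NumVPA s) (J : Option (Fin B.procs)) :
    {t // (B.stateEquiv t).1 = J} ≃ Fin B.states where
  toFun t := (B.stateEquiv t).2
  invFun q := ⟨B.stateEquiv.symm (J, q), by simp⟩
  left_inv := by
    rintro ⟨t, rfl⟩
    simp
  right_inv q := by simp

/-- The numbered visibly recursive automaton with the same language. -/
def toNumVRA (B : NumVPA s) : NumVRA s where
  procs := B.procs
  states := (B.procs + 1) * B.states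
  owner t := (B.stateEquiv t).1
  toVRA := B.toVPA.toVRA B.procEquiv B.copyEquiv

/-- The procedural symbol with the given components. -/
def proc (B : NumVPA s) (q q' : Fin B.states) (c : Fin s.call) (r : Fin s.ret) :
    Fin B.toNumVRA.procs :=
  B.procEquiv.symm ((q, q'), c, r)

/-- The state `q` of the automaton `J`. -/
def copy (B : NumVPA s) (J : Option (Fin B.toNumVRA.procs)) (q : Fin B.states) :
    Fin B.toNumVRA.states :=
  B.stateEquiv.symm (J, q)

variable (B : NumVPA s)

theorem stateAt_copy (J : Option (Fin B.toNumVRA.procs)) (q : Fin B.states) :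
    B.toNumVRA.stateAt (B.copy J q) = ⟨J, (B.copyEquiv J).symm q⟩ := by
  have h : B.toNumVRA.owner (B.copy J q) = J :=
    congrArg Prod.fst (B.stateEquiv.apply_symm_apply (J, q))
  generalize ht : B.copy J q = t at h
  subst h
  refine congrArg (Sigma.mk _) (Subtype.ext ?_)
  exact ht.symm

theorem owner_copy (J : Option (Fin B.toNumVRA.procs)) (q : Fin B.states) :
    B.toNumVRA.owner (B.copy J q) = J :=
  congrArg Sigma.fst (B.stateAt_copy J q)

theorem table_procs (f : Fin B.toNumVRA.procs → List Bool) :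
    table B.toNumVRA.procs f = table B.states fun q => table B.states fun q' =>
      table s.call fun c => table s.ret fun r => f (B.proc q q' c r) := by
  refine (table_mul _ _ _).trans ((table_mul _ _ _).trans ?_)
  refine table_congr fun q => table_congr fun q' => ?_
  exact table_mul _ _ _

theorem table_states (f : Fin B.toNumVRA.states → List Bool) :
    table B.toNumVRA.states f = (table B.states fun q => f (B.copy none q)) ++
      table B.states fun q => table B.states fun q' => table s.call fun c => table s.ret fun r =>
        table B.states fun p => f (B.copy (some (B.proc q q' c r)) p) := by
  refine (table_mul _ _ _).trans ((table_succ _ _).trans ?_)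
  refine congrArg₂ _ rfl ?_
  refine (B.table_procs _).trans ?_
  refine table_congr fun q => table_congr fun q' => table_congr fun c => table_congr fun r =>
    table_congr fun p => congrArg f ?_
  simp [copy, stateEquiv, finSuccEquiv]
  rfl

theorem copy_mem_initials {J : Option (Fin B.toNumVRA.procs)} {q : Fin B.states} :
    B.toNumVRA.stateAt (B.copy J q) ∈
      B.toNumVRA.toVRA.initials (B.toNumVRA.owner (B.copy J q)) ↔
      q ∈ J.elim B.toVPA.start fun K => {(B.procEquiv K).1.1} := by
  rw [owner_copy, stateAt_copy]
  refine VRA.mk_mem_initials.trans ((and_iff_right rfl).trans ?_)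
  change B.copyEquiv J ((B.copyEquiv J).symm q) ∈
    (J.elim B.toVPA.start fun K => {(B.procEquiv K).1.1} : Set (Fin B.states)) ↔ _
  rw [Equiv.apply_symm_apply]

theorem copy_mem_finals {J : Option (Fin B.toNumVRA.procs)} {q : Fin B.states} :
    B.toNumVRA.stateAt (B.copy J q) ∈
      B.toNumVRA.toVRA.finals (B.toNumVRA.owner (B.copy J q)) ↔
      q ∈ J.elim B.toVPA.accept fun K => {(B.procEquiv K).1.2} := by
  rw [owner_copy, stateAt_copy]
  refine VRA.mk_mem_finals.trans ((and_iff_right rfl).trans ?_)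
  change B.copyEquiv J ((B.copyEquiv J).symm q) ∈
    (J.elim B.toVPA.accept fun K => {(B.procEquiv K).1.2} : Set (Fin B.states)) ↔ _
  rw [Equiv.apply_symm_apply]

theorem copy_mem_trans {J J' : Option (Fin B.toNumVRA.procs)} {q p : Fin B.states}
    {x : Fin s.int ⊕ Fin B.toNumVRA.procs} :
    (B.toNumVRA.stateAt (B.copy J q), x, B.toNumVRA.stateAt (B.copy J' p)) ∈
      B.toNumVRA.toVRA.trans ↔
      J = J' ∧ (B.copyEquiv J).symm p ∈
        (B.toNumVRA.toVRA.aut J).step ((B.copyEquiv J).symm q) x := by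
  rw [stateAt_copy, stateAt_copy]
  refine VRA.mk_mem_trans.trans ?_
  constructor
  · rintro ⟨p', hp', h⟩
    cases h
    exact ⟨rfl, hp'⟩
  · rintro ⟨rfl, h⟩
    exact ⟨_, h, rfl⟩

theorem copy_mem_intTrans {J J' : Option (Fin B.toNumVRA.procs)} {q p : Fin B.states}
    {a : Fin s.int} :
    (B.toNumVRA.stateAt (B.copy J q), Sum.inl a, B.toNumVRA.stateAt (B.copy J' p)) ∈
      B.toNumVRA.toVRA.trans ↔ J = J' ∧ (q, a, p) ∈ B.toVPA.intTrans := by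
  refine B.copy_mem_trans.trans (and_congr_right fun _ => ?_)
  change (B.copyEquiv J ((B.copyEquiv J).symm q), a, B.copyEquiv J ((B.copyEquiv J).symm p)) ∈
    B.toVPA.intTrans ↔ _
  rw [Equiv.apply_symm_apply, Equiv.apply_symm_apply]

theorem copy_mem_procTrans {J J' : Option (Fin B.toNumVRA.procs)} {q p t t' : Fin B.states}
    {c : Fin s.call} {r : Fin s.ret} :
    (B.toNumVRA.stateAt (B.copy J q), Sum.inr (B.proc t t' c r),
      B.toNumVRA.stateAt (B.copy J' p)) ∈ B.toNumVRA.toVRA.trans ↔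
      J = J' ∧ ∃ g, (q, c, t, g) ∈ B.toVPA.callTrans ∧ (t', r, g, p) ∈ B.toVPA.retTrans := by
  refine B.copy_mem_trans.trans (and_congr_right fun _ => ?_)
  change (∃ g, (B.copyEquiv J ((B.copyEquiv J).symm q), (B.procEquiv (B.proc t t' c r)).2.1,
    (B.procEquiv (B.proc t t' c r)).1.1, g) ∈ B.toVPA.callTrans ∧
    ((B.procEquiv (B.proc t t' c r)).1.2, (B.procEquiv (B.proc t t' c r)).2.2, g,
      B.copyEquiv J ((B.copyEquiv J).symm p)) ∈ B.toVPA.retTrans) ↔ _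
  simp only [Equiv.apply_symm_apply, proc]

theorem proc_inj {q₁ q₁' q₂ q₂' : Fin B.states} {c₁ c₂ : Fin s.call} {r₁ r₂ : Fin s.ret} :
    B.proc q₁ q₁' c₁ r₁ = B.proc q₂ q₂' c₂ r₂ ↔
      (q₁.val = q₂ ∧ q₁'.val = q₂') ∧ c₁.val = c₂ ∧ r₁.val = r₂ := by
  exact B.procEquiv.symm.injective.eq_iff.trans (by simp [Fin.ext_iff])

/-- The numbers at the beginning of the encoding. -/
def header (B : NumVPA s) : List ℕ := [s.int, s.call, s.ret, B.stackSyms, B.states]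

namespace Bits

/-! In the following formulas, the variables `0`, …, `4` stand for the numbers of internal, call and
return symbols, stack symbols and states. -/

/-- The address behind the header. -/
def addr₀ : AddressTerm := .var 0 + .var 1 + .var 2 + .var 3 + .var 4 + 5

/-- The address behind the table of initial states. -/
def addr₁ : AddressTerm := addr₀ + .var 4

/-- The address behind the table of final states. -/
def addr₂ : AddressTerm := addr₁ + .var 4

/-- The address behind the table of internal transitions. -/
def addr₃ : AddressTerm := addr₂ + .var 4 * .var 0 * .var 4

/-- The address behind the table of call transitions. -/
def addr₄ : AddressTerm := addr₃ + .var 4 * .var 1 * .var 4 * .var 3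

/-- The state `q` is initial. -/
def initial (q : ℕ) : TableFormula := .bit (addr₀ + .var q)

/-- The state `q` is final. -/
def final (q : ℕ) : TableFormula := .bit (addr₁ + .var q)

/-- There is an internal transition from `q` to `p` that reads `a`. -/
def intTrans (q a p : ℕ) : TableFormula :=
  .bit (addr₂ + .var q * (.var 0 * .var 4) + .var a * .var 4 + .var p)

/-- There is a call transition from `q` to `p` that reads `c` and pushes `g`. -/
def callTrans (q c p g : ℕ) : TableFormula :=
  .bit (addr₃ + .var q * (.var 1 * .var 4 * .var 3) + .var c * (.var 4 * .var 3) +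
    .var p * .var 3 + .var g)

/-- There is a return transition from `q` to `p` that reads `r` and pops `g`. -/
def retTrans (q r g p : ℕ) : TableFormula :=
  .bit (addr₄ + .var q * (.var 2 * .var 3 * .var 4) + .var r * (.var 3 * .var 4) +
    .var g * .var 4 + .var p)

variable (B : NumVPA s) {ρ : List ℕ}

/-- The tables follow one another in the encoding at the addresses given by the terms. -/
theorem occursAt_tables (hρ : B.header <+: ρ) :
    OccursAt B.encode 0 (unary s.int ++ unary s.call ++ unary s.ret ++ unary B.stackSyms ++
      unary B.states) ∧
    OccursAt B.encode (addr₀.eval ρ) (table B.states fun q => truthBit (q ∈ B.toVPA.start)) ∧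
    OccursAt B.encode (addr₁.eval ρ) (table B.states fun q => truthBit (q ∈ B.toVPA.accept)) ∧
    OccursAt B.encode (addr₂.eval ρ)
      (table B.states fun q => table s.int fun a => table B.states fun p =>
        truthBit ((q, a, p) ∈ B.toVPA.intTrans)) ∧
    OccursAt B.encode (addr₃.eval ρ)
      (table B.states fun q => table s.call fun c => table B.states fun p =>
        table B.stackSyms fun g => truthBit ((q, c, p, g) ∈ B.toVPA.callTrans)) ∧
    OccursAt B.encode (addr₄.eval ρ)
      (table B.states fun q => table s.ret fun r => table B.stackSyms fun g =>
        table B.states fun p => truthBit ((q, r, g, p) ∈ B.toVPA.retTrans)) := by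
  have h := OccursAt.refl B.encode
  obtain ⟨σ, rfl⟩ := hρ
  have h₄ := h.right
  have h₃ := h.left.right
  have h₂ := h.left.left.right
  have h₁ := h.left.left.left.right
  have h₀ := h.left.left.left.left.right
  have e₀ : addr₀.eval (B.header ++ σ) = s.int + s.call + s.ret + B.stackSyms + B.states + 5 := rfl
  have e₁ : addr₁.eval (B.header ++ σ) = addr₀.eval (B.header ++ σ) + B.states := rfl
  have e₂ : addr₂.eval (B.header ++ σ) = addr₁.eval (B.header ++ σ) + B.states := rfl
  have e₃ : addr₃.eval (B.header ++ σ) =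
      addr₂.eval (B.header ++ σ) + B.states * s.int * B.states := rfl
  have e₄ : addr₄.eval (B.header ++ σ) =
      addr₃.eval (B.header ++ σ) + B.states * s.call * B.states * B.stackSyms := rfl
  simp only [List.length_append, length_unary, length_table₁, length_table₃, length_table₄]
    at h₀ h₁ h₂ h₃ h₄
  exact ⟨h.left.left.left.left.left, h₀.congr (by omega), h₁.congr (by omega),
    h₂.congr (by omega), h₃.congr (by omega), h₄.congr (by omega)⟩

theorem getD_header (hρ : B.header <+: ρ) : ρ.getD 0 0 = s.int ∧ ρ.getD 1 0 = s.call ∧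
    ρ.getD 2 0 = s.ret ∧ ρ.getD 3 0 = B.stackSyms ∧ ρ.getD 4 0 = B.states := by
  obtain ⟨σ, rfl⟩ := hρ
  exact ⟨rfl, rfl, rfl, rfl, rfl⟩

variable {B} {i j k l : ℕ}

theorem eval_initial (hρ : B.header <+: ρ) {q : Fin B.states} (hq : ρ.getD i 0 = q) :
    (initial i).eval B.encode ρ = true ↔ q ∈ B.toVPA.start := by
  have h := (occursAt_tables B hρ).2.1.getD_table q
  rw [← h, ← hq]
  rfl

theorem eval_final (hρ : B.header <+: ρ) {q : Fin B.states} (hq : ρ.getD i 0 = q) :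
    (final i).eval B.encode ρ = true ↔ q ∈ B.toVPA.accept := by
  have h := (occursAt_tables B hρ).2.2.1.getD_table q
  rw [← h, ← hq]
  rfl

theorem eval_intTrans (hρ : B.header <+: ρ) {q p : Fin B.states} {a : Fin s.int}
    (hq : ρ.getD i 0 = q) (ha : ρ.getD j 0 = a) (hp : ρ.getD k 0 = p) :
    (intTrans i j k).eval B.encode ρ = true ↔ (q, a, p) ∈ B.toVPA.intTrans := by
  have h := (((occursAt_tables B hρ).2.2.2.1.table (fun _ => length_table₂) q).table
    (fun _ => length_table₁) a).getD_table p
  obtain ⟨h₀, -, -, -, h₄⟩ := getD_header B hρ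
  rw [← h, ← hq, ← ha, ← hp, ← h₀, ← h₄]
  rfl

theorem eval_callTrans (hρ : B.header <+: ρ) {q p : Fin B.states} {c : Fin s.call}
    {g : Fin B.stackSyms} (hq : ρ.getD i 0 = q) (hc : ρ.getD j 0 = c) (hp : ρ.getD k 0 = p)
    (hg : ρ.getD l 0 = g) :
    (callTrans i j k l).eval B.encode ρ = true ↔ (q, c, p, g) ∈ B.toVPA.callTrans := by
  have h := ((((occursAt_tables B hρ).2.2.2.2.1.table (fun _ => length_table₃) q).table
    (fun _ => length_table₂) c).table (fun _ => length_table₁) p).getD_table g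
  obtain ⟨-, h₁, -, h₃, h₄⟩ := getD_header B hρ
  rw [← h, ← hq, ← hc, ← hp, ← hg, ← h₁, ← h₃, ← h₄]
  rfl

theorem eval_retTrans (hρ : B.header <+: ρ) {q p : Fin B.states} {r : Fin s.ret}
    {g : Fin B.stackSyms} (hq : ρ.getD i 0 = q) (hr : ρ.getD j 0 = r) (hg : ρ.getD k 0 = g)
    (hp : ρ.getD l 0 = p) :
    (retTrans i j k l).eval B.encode ρ = true ↔ (q, r, g, p) ∈ B.toVPA.retTrans := by
  have h := ((((occursAt_tables B hρ).2.2.2.2.2.table (fun _ => length_table₃) q).table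
    (fun _ => length_table₂) r).table (fun _ => length_table₁) g).getD_table p
  obtain ⟨-, -, h₂, h₃, h₄⟩ := getD_header B hρ
  rw [← h, ← hq, ← hr, ← hp, ← hg, ← h₂, ← h₃, ← h₄]
  rfl

end Bits

open Bits TableProgram

/-- Execute a program for all procedural symbols, the components of which are the next four
variables. -/
def loopProcs (c : TableProgram) : TableProgram := loop 4 <| loop 4 <| loop 1 <| loop 2 c

/-- Execute the program `c₀` for all states of the starting automaton, and the program `c` for all
states of the other automata. For `c₀` the next variable is the original of the state; for `c` the
next four variables are the components of the procedural symbol, and a fifth is the original of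
the state. -/
def loopStates (c₀ c : TableProgram) : TableProgram := (loop 4 c₀).seq (loopProcs (loop 4 c))

variable {B}

theorem eval_loopProcs {x : List Bool} {c : TableProgram} {ρ : List ℕ} (hρ : B.header <+: ρ)
    {f : Fin B.toNumVRA.procs → List Bool}
    (h : ∀ q q' a r, c.eval x (ρ ++ [q.val] ++ [q'.val] ++ [a.val] ++ [r.val]) =
      f (B.proc q q' a r)) :
    (loopProcs c).eval x ρ = table B.toNumVRA.procs f := by
  obtain ⟨σ, rfl⟩ := hρ
  rw [table_procs]
  exact eval_loop rfl fun q => eval_loop rfl fun q' => eval_loop rfl fun a => eval_loop rfl fun r =>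
    h q q' a r

theorem eval_loopStates {x : List Bool} {c₀ c : TableProgram} {ρ : List ℕ} (hρ : B.header <+: ρ)
    {f : Fin B.toNumVRA.states → List Bool}
    (h₀ : ∀ p, c₀.eval x (ρ ++ [p.val]) = f (B.copy none p))
    (h : ∀ q q' a r p, c.eval x (ρ ++ [q.val] ++ [q'.val] ++ [a.val] ++ [r.val] ++ [p.val]) =
      f (B.copy (some (B.proc q q' a r)) p)) :
    (loopStates c₀ c).eval x ρ = table B.toNumVRA.states f := by
  obtain ⟨σ, rfl⟩ := hρ
  rw [table_states]
  refine congrArg₂ _ (eval_loop (n := B.states) rfl h₀) ?_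
  exact eval_loop rfl fun q => eval_loop rfl fun q' => eval_loop rfl fun a => eval_loop rfl fun r =>
    eval_loop rfl fun p => h q q' a r p

/-- The procedural symbols whose components start with the variables `i` and `j` are equal. -/
def eqProc (i j : ℕ) : TableFormula :=
  ((TableFormula.eq i j).and (.eq (i + 1) (j + 1))).and
    ((TableFormula.eq (i + 2) (j + 2)).and (.eq (i + 3) (j + 3)))

/-- There is a transition from `q` to `p` that reads the procedural symbol whose components start
with the variable `j`; the variable `g` is the next one. -/
def procTrans (q j p g : ℕ) : TableFormula :=
  TableFormula.ex 3 <| (callTrans q (j + 2) j g).and (retTrans (j + 1) (j + 3) g p)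

/-- The program that writes the encoding of the visibly recursive automaton. -/
def program : TableProgram :=
  withHeader <|
  (terminate <| loop 0 <| emit .tt).seq <|
  (terminate <| loop 1 <| emit .tt).seq <|
  (terminate <| loop 2 <| emit .tt).seq <|
  (terminate <| loopProcs <| emit .tt).seq <|
  (terminate <| loopStates (emit .tt) (emit .tt)).seq <|
  (loopProcs <| loop 1 <| emit <| .eq 7 9).seq <|
  (loopProcs <| loop 2 <| emit <| .eq 8 9).seq <|
  (loopStates (emit .tt) (emit <| .not .tt)).seq <|
  (loopStates (loopProcs <| emit <| .not .tt) (loopProcs <| emit <| eqProc 5 10)).seq <|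
  (loopStates (emit <| initial 5) (emit <| .eq 9 5)).seq <|
  (loopStates (emit <| final 5) (emit <| .eq 9 6)).seq <|
  (loopStates
    (loop 0 <| loopStates (emit <| intTrans 5 6 7) (emit <| .not .tt))
    (loop 0 <| loopStates (emit <| .not .tt)
      (emit <| (eqProc 5 11).and <| intTrans 9 10 15))).seq <|
  loopStates
    (loopProcs <| loopStates (emit <| procTrans 5 6 10 11) (emit <| .not .tt))
    (loopProcs <| loopStates (emit <| .not .tt)
      (emit <| (eqProc 5 14).and <| procTrans 9 10 18 19))

theorem eval_ff {x : List Bool} {ρ : List ℕ} {p : Prop} (hp : ¬p) :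
    (TableFormula.not .tt).eval x ρ = true ↔ p :=
  iff_of_false (by simp [TableFormula.eval]) hp

theorem eval_tt {x : List Bool} {ρ : List ℕ} {p : Prop} (hp : p) :
    TableFormula.tt.eval x ρ = true ↔ p :=
  iff_of_true rfl hp

theorem eval_eqProc {x : List Bool} {ρ : List ℕ} {i j : ℕ} {q₁ q₁' q₂ q₂' : Fin B.states}
    {c₁ c₂ : Fin s.call} {r₁ r₂ : Fin s.ret}
    (h₁ : ρ.getD i 0 = q₁ ∧ ρ.getD (i + 1) 0 = q₁' ∧ ρ.getD (i + 2) 0 = c₁ ∧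
      ρ.getD (i + 3) 0 = r₁)
    (h₂ : ρ.getD j 0 = q₂ ∧ ρ.getD (j + 1) 0 = q₂' ∧ ρ.getD (j + 2) 0 = c₂ ∧
      ρ.getD (j + 3) 0 = r₂) :
    (eqProc i j).eval x ρ = true ↔ B.proc q₁ q₁' c₁ r₁ = B.proc q₂ q₂' c₂ r₂ := by
  rw [proc_inj, eqProc]
  simp only [TableFormula.eval_and, TableFormula.eval_eq, h₁, h₂]

theorem eval_procTrans {ρ : List ℕ} (hρ : B.header <+: ρ) {i j k : ℕ} {q p t t' : Fin B.states}
    {c : Fin s.call} {r : Fin s.ret} (hq : ρ[i]? = some q.val) (hp : ρ[k]? = some p.val)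
    (ht : ρ[j]? = some t.val) (ht' : ρ[j + 1]? = some t'.val) (hc : ρ[j + 2]? = some c.val)
    (hr : ρ[j + 3]? = some r.val) :
    (procTrans i j k ρ.length).eval B.encode ρ = true ↔
      ∃ g, (q, c, t, g) ∈ B.toVPA.callTrans ∧ (t', r, g, p) ∈ B.toVPA.retTrans := by
  have h : ∀ {i m : ℕ} (g : ℕ), ρ[i]? = some m → (ρ ++ [g]).getD i 0 = m := by
    intro i m g hi
    obtain ⟨hlt, hm⟩ := List.getElem?_eq_some_iff.1 hi
    rw [List.getD_append _ _ _ _ hlt, List.getD_eq_getElem _ _ hlt, hm]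
  have hg : ∀ g : ℕ, (ρ ++ [g]).getD ρ.length 0 = g := fun g => by simp
  rw [procTrans, TableFormula.eval_ex (getD_header B hρ).2.2.2.1]
  refine exists_congr fun g => ?_
  have hρ' : B.header <+: ρ ++ [g.val] := hρ.trans (List.prefix_append _ _)
  rw [TableFormula.eval_and, eval_callTrans hρ' (h _ hq) (h _ hc) (h _ ht) (hg _),
    eval_retTrans hρ' (h _ ht') (h _ hr) (hg _) (h _ hp)]

theorem eval_program (B : NumVPA s) : program.eval B.encode [] = B.toNumVRA.encode := by
  rw [program, eval_withHeader (occursAt_tables B (List.prefix_refl _)).1]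
  have hpre : ∀ σ, B.header <+: B.header ++ σ := fun σ => List.prefix_append _ σ
  have hsome : ∀ {K K' : Fin B.toNumVRA.procs}, some K = some K' ↔ K = K' := Option.some_inj
  simp only [TableProgram.eval_seq, NumVRA.encode, List.append_assoc]
  refine congrArg₂ _ (eval_terminate (eval_ones rfl)) <|
    congrArg₂ _ (eval_terminate (eval_ones rfl)) <|
    congrArg₂ _ (eval_terminate (eval_ones rfl)) <|
    congrArg₂ _ (eval_terminate ?_) <| congrArg₂ _ (eval_terminate ?_) <|
    congrArg₂ _ ?_ <| congrArg₂ _ ?_ <| congrArg₂ _ ?_ <| congrArg₂ _ ?_ <|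
    congrArg₂ _ ?_ <| congrArg₂ _ ?_ <| congrArg₂ _ ?_ ?_
  · exact eval_loopProcs (hpre []) fun q q' c r => eval_emit (eval_tt trivial)
  · exact eval_loopStates (hpre []) (fun p => eval_emit (eval_tt trivial))
      fun q q' c r p => eval_emit (eval_tt trivial)
  · refine eval_loopProcs (hpre []) fun q q' c r => eval_loop rfl fun c' => eval_emit ?_
    rw [TableFormula.eval_eq]
    change c.val = c'.val ↔ (B.procEquiv (B.proc q q' c r)).2.1 = c'
    simp [proc, Fin.ext_iff]
  · refine eval_loopProcs (hpre []) fun q q' c r => eval_loop rfl fun r' => eval_emit ?_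
    rw [TableFormula.eval_eq]
    change r.val = r'.val ↔ (B.procEquiv (B.proc q q' c r)).2.2 = r'
    simp [proc, Fin.ext_iff]
  · refine eval_loopStates (hpre []) (fun p => eval_emit (eval_tt (B.owner_copy none p)))
      fun q q' c r p => eval_emit (eval_ff ?_)
    rw [owner_copy]
    simp
  · refine eval_loopStates (hpre [])
      (fun p => eval_loopProcs (hpre [p.val]) fun q q' c r => eval_emit (eval_ff ?_))
      fun q q' c r p => eval_loopProcs (hpre [q.val, q'.val, c.val, r.val, p.val])
        fun q₁ q₁' c₁ r₁ => eval_emit ?_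
    · rw [owner_copy]
      simp
    · rw [owner_copy, hsome]
      exact eval_eqProc ⟨rfl, rfl, rfl, rfl⟩ ⟨rfl, rfl, rfl, rfl⟩
  · refine eval_loopStates (hpre []) (fun p => eval_emit ?_) fun q q' c r p => eval_emit ?_
    · rw [copy_mem_initials]
      exact eval_initial (hpre [p.val]) rfl
    · rw [copy_mem_initials, TableFormula.eval_eq]
      change p.val = q.val ↔ p ∈ ({(B.procEquiv (B.proc q q' c r)).1.1} : Set _)
      simp [proc, Fin.ext_iff]
  · refine eval_loopStates (hpre []) (fun p => eval_emit ?_) fun q q' c r p => eval_emit ?_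
    · rw [copy_mem_finals]
      exact eval_final (hpre [p.val]) rfl
    · rw [copy_mem_finals, TableFormula.eval_eq]
      change p.val = q'.val ↔ p ∈ ({(B.procEquiv (B.proc q q' c r)).1.2} : Set _)
      simp [proc, Fin.ext_iff]
  · refine eval_loopStates (hpre []) (fun p => eval_loop rfl fun a => eval_loopStates
      (hpre [p.val, a.val]) (fun p₁ => eval_emit ?_) fun q₁ q₁' c₁ r₁ p₁ => eval_emit (eval_ff ?_))
      fun q q' c r p => eval_loop rfl fun a => eval_loopStates
        (hpre [q.val, q'.val, c.val, r.val, p.val, a.val]) (fun p₁ => eval_emit (eval_ff ?_))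
        fun q₁ q₁' c₁ r₁ p₁ => eval_emit ?_
    · rw [copy_mem_intTrans]
      exact (eval_intTrans (hpre [p.val, a.val, p₁.val]) rfl rfl rfl).trans (and_iff_right rfl).symm
    · rw [copy_mem_intTrans]
      simp
    · rw [copy_mem_intTrans]
      simp
    · rw [copy_mem_intTrans, TableFormula.eval_and, hsome]
      exact and_congr (eval_eqProc ⟨rfl, rfl, rfl, rfl⟩ ⟨rfl, rfl, rfl, rfl⟩)
        (eval_intTrans (hpre [q.val, q'.val, c.val, r.val, p.val, a.val, q₁.val, q₁'.val, c₁.val,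
          r₁.val, p₁.val]) rfl rfl rfl)
  · refine eval_loopStates (hpre []) (fun p => eval_loopProcs (hpre [p.val]) fun t t' a b =>
      eval_loopStates (hpre [p.val, t.val, t'.val, a.val, b.val]) (fun p₁ => eval_emit ?_)
        fun q₁ q₁' c₁ r₁ p₁ => eval_emit (eval_ff ?_))
      fun q q' c r p => eval_loopProcs (hpre [q.val, q'.val, c.val, r.val, p.val])
        fun t t' a b => eval_loopStates
          (hpre [q.val, q'.val, c.val, r.val, p.val, t.val, t'.val, a.val, b.val])
          (fun p₁ => eval_emit (eval_ff ?_)) fun q₁ q₁' c₁ r₁ p₁ => eval_emit ?_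
    · rw [copy_mem_procTrans]
      exact (eval_procTrans (hpre [p.val, t.val, t'.val, a.val, b.val, p₁.val])
        rfl rfl rfl rfl rfl rfl).trans (and_iff_right rfl).symm
    · rw [copy_mem_procTrans]
      simp
    · rw [copy_mem_procTrans]
      simp
    · rw [copy_mem_procTrans, TableFormula.eval_and, hsome]
      exact and_congr (eval_eqProc ⟨rfl, rfl, rfl, rfl⟩ ⟨rfl, rfl, rfl, rfl⟩)
        (eval_procTrans (hpre [q.val, q'.val, c.val, r.val, p.val, t.val, t'.val, a.val, b.val,
          q₁.val, q₁'.val, c₁.val, r₁.val, p₁.val]) rfl rfl rfl rfl rfl rfl)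

theorem logspaceComputable_toNumVRA :
    LogspaceComputable (fun B : Σ s, NumVPA s => B.2.encode) (fun A : Σ s, NumVRA s => A.2.encode)
      (fun B => ⟨B.1, B.2.toNumVRA⟩) :=
  -- At most twenty variables are in use at a time; four counters serve to compute addresses.
  program.logspaceComputable 24 (by decide) fun B => eval_program B.2

end NumVPA

/-! ### The equivalence -/

theorem mainTheorem4 :
    (∀ (I C R : Type*) [Finite I] [Finite C] [Finite R] (L : Language (Letter I C R)),
      (∀ w ∈ L, WellMatched w) → (AcceptedByVRA L ↔ AcceptedByVPA L)) ∧
    (∃ f : ∀ s : AlphabetSize, NumVRA s → NumVPA s,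
      LogspaceComputable (fun A : Σ s, NumVRA s => A.2.encode) (fun B : Σ s, NumVPA s => B.2.encode)
        (fun A => ⟨A.1, f A.1 A.2⟩) ∧
      (∀ (s : AlphabetSize) (A : NumVRA s), (f s A).language = A.language) ∧
      ∃ K : ℕ, ∀ (s : AlphabetSize) (A : NumVRA s), (f s A).size ≤ K * A.size ^ 2) ∧
    (∃ g : ∀ s : AlphabetSize, NumVPA s → NumVRA s,
      LogspaceComputable (fun B : Σ s, NumVPA s => B.2.encode) (fun A : Σ s, NumVRA s => A.2.encode)
        (fun B => ⟨B.1, g B.1 B.2⟩) ∧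
      (∀ (s : AlphabetSize) (B : NumVPA s), (g s B).language = B.language) ∧
      ∀ s : AlphabetSize, ∃ K : ℕ, ∀ B : NumVPA s, (g s B).size ≤ K * B.size ^ 4) := by
  refine ⟨fun I C R _ _ _ L _ => acceptedByVRA_iff_acceptedByVPA L,
    ⟨fun _ A => A.toNumVPA, NumVRA.logspaceComputable_toNumVPA,
      fun _ A => A.toVRA.toVPA_language _, 2, fun _ A => A.toVRA.toVPA_size_le _⟩,
    ⟨fun _ B => B.toNumVRA, NumVPA.logspaceComputable_toNumVRA,
      fun _ B => B.toVPA.toVRA_language _ _, fun s => ⟨_, fun B => B.toVPA.toVRA_size_le _ _⟩⟩⟩
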